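/- Let $K$ be one of the semirings $\mathbb{Q}_{\max}=(\mathbb{Q}\cup\{-\infty\},\max,+)$, $\mathbb{Z}_{\max}=(\mathbb{Z}\cup\{-\infty\},\max,+)$ or $\mathbb{N}_{\min}=(\mathbb{N}\cup\{+\infty\},\min,+)$. A realization of dimension $N\ge 0$ of a sequence $S_0,S_1,\ldots$ of elements of $K$ is a triple $(c,A,b)$ with $c\in K^{1\times N}$, $A\in K^{N\times N}$, $b\in K^{N\times 1}$ such that $S_k=cA^kb$ for all $k\ge 0$, the products being taken in the semiring $K$; $S$ is $K$-recognizable if it has a realization of some dimension. Then it is decidable whether a $K$-recognizable sequence has a realization of a given dimension: there is an algorithm which, given any realization (of any dimension $M$) of a $K$-recognizable sequence $S$ and any $N\in\mathbb{N}$, decides whether $S$ has a realization of dimension $N$ over $K$. Moreover, the minimal realization problem over $K$ is solvable by an algorithm: there is an algorithm which, given any realization of a $K$-recognizable sequence $S$, returns a realization of $S$ over $K$ of the smallest possible dimension. -/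

import Mathlib

open scoped Matrix

/-- The max-plus semiring `ℚ ∪ {-∞}` with `a ⊕ b = max a b` and `a ⊗ b = a + b`. Mathlib's
`Tropical` takes `min` as addition, hence the order dual: `⊤ : WithTop ℚᵒᵈ` plays the role of
`-∞`, and `min` in `ℚᵒᵈ` is `max` in `ℚ`. -/
abbrev Qmax : Type := Tropical (WithTop ℚᵒᵈ)

/-- The semiring of max-plus integers `(ℤ ∪ {-∞}, max, +)`; `⊤ : WithTop ℤᵒᵈ` is `-∞`. -/
abbrev Zmax : Type := Tropical (WithTop ℤᵒᵈ)

/-- The min-plus semiring `(ℕ ∪ {+∞}, min, +)`. -/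
abbrev Nmin : Type := Tropical (WithTop ℕ)

/-- The finite representation of an element of `Qmax`: `none` for `-∞`, and the pair
(numerator, denominator) of the reduced fraction for a rational number. -/
def Qmax.encode (x : Qmax) : Option (ℤ × ℕ) :=
  match Tropical.untrop x with
  | ⊤ => none
  | (q : ℚᵒᵈ) => some ((OrderDual.ofDual q).num, (OrderDual.ofDual q).den)

/-- The finite representation of an element of `Zmax`: `none` for `-∞`. -/
def Zmax.encode (x : Zmax) : Option ℤ :=
  match Tropical.untrop x with
  | ⊤ => none
  | (z : ℤᵒᵈ) => some (OrderDual.ofDual z)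

/-- The finite representation of an element of `Nmin`: `none` for `+∞`. -/
def Nmin.encode (x : Nmin) : Option ℕ :=
  match Tropical.untrop x with
  | ⊤ => none
  | (n : ℕ) => some n

/-- A triple `(c, A, b)` of dimension `N` over `K`: a row vector `c`, a square matrix `A` and a
column vector `b`. -/
structure Realization (K : Type) (N : ℕ) where
  /-- the row vector -/
  c : Fin N → K
  /-- the square matrix -/
  A : Matrix (Fin N) (Fin N) K
  /-- the column vector -/
  b : Fin N → K

/-- `(c, A, b)` is a realization of the sequence `S`: `S k = c A ^ k b` for all `k`. -/
def Realization.Recognizes {K : Type} [CommSemiring K] {N : ℕ} (r : Realization K N)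
    (S : ℕ → K) : Prop :=
  ∀ k : ℕ, S k = r.c ⬝ᵥ (r.A ^ k *ᵥ r.b)

/-- The sequence `S` has a realization of dimension `N` over `K`. -/
def HasRealization {K : Type} [CommSemiring K] (S : ℕ → K) (N : ℕ) : Prop :=
  ∃ r : Realization K N, r.Recognizes S

/-- `r` is a realization of `S` of the smallest possible dimension. -/
def Realization.IsMinimalFor {K : Type} [CommSemiring K] {N : ℕ} (r : Realization K N)
    (S : ℕ → K) : Prop :=
  r.Recognizes S ∧ ∀ N' : ℕ, HasRealization S N' → N ≤ N'

/-- Finite data describing a triple: its dimension, the list of the entries of `c`, the list of the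
rows of `A`, and the list of the entries of `b`, each entry being given by an element of `κ`. -/
abbrev RealizationCode (κ : Type) : Type := ℕ × List κ × List (List κ) × List κ

/-- The code of a triple, given a representation `enc` of the elements of `K`. -/
def Realization.code {K κ : Type} (enc : K → κ) {N : ℕ} (r : Realization K N) :
    RealizationCode κ :=
  (N, List.ofFn fun i => enc (r.c i),
    List.ofFn fun i => List.ofFn fun j => enc (r.A i j),
    List.ofFn fun i => enc (r.b i))

/-- There is one algorithm which, given any realization (of any dimension `M`) of a
`K`-recognizable sequence `S` and any `N`, decides whether `S` has a realization of dimension `N`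
over `K`. -/
def RealizationProblemDecidable {K κ : Type} [CommSemiring K] [Primcodable κ]
    (enc : K → κ) : Prop :=
  ∃ decide : RealizationCode κ × ℕ → Bool, Computable decide ∧
    ∀ (S : ℕ → K) (M : ℕ) (r : Realization K M), r.Recognizes S →
      ∀ N : ℕ, decide (r.code enc, N) = true ↔ HasRealization S N

/-- There is one algorithm which, given any realization (of any dimension `M`) of a
`K`-recognizable sequence `S`, returns a realization of `S` over `K` of minimal dimension. -/
def MinimalRealizationComputable {K κ : Type} [CommSemiring K] [Primcodable κ]
    (enc : K → κ) : Prop :=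
  ∃ minimize : RealizationCode κ → RealizationCode κ, Computable minimize ∧
    ∀ (S : ℕ → K) (M : ℕ) (r : Realization K M), r.Recognizes S →
      ∃ (N : ℕ) (r' : Realization K N), minimize (r.code enc) = r'.code enc ∧ r'.IsMinimalFor S

/-! After the change of sign `x ↦ -x` for the max-plus cases, a triple is a weighted graph and `S k`
is the minimum of the weights of its runs of length `k`. The weight of a run is linear in the
entries and depends only on its end points and edge multiplicities.

Equality of recognizable sequences can be tested. If `n` bounds the dimension and `W` the integer
weights, then from an explicit index on `S` is geometric along every residue class modulo `n !`
(`Recognizes.exists_cyclic`), so agreement on an explicit initial segment implies equality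
(`Recognizes.eq_of_forall_lt`).

Realizations can be taken small (`Recognizes.exists_small`). Fix the support of some realization.
Its weights realize `S` because every run of length `k` weighs at least `S k` and, where `S k` is
finite, some run attains it. Pumping splits a run into a short run with the same vertices and loops
of length `n !` at these vertices. By cyclicity the lower bound for the run is a sum of lower bounds
for the pieces, and a tight run has tight pieces. Hence finitely many homogeneous inequalities with
bounded coefficients, in the weights and a scaling factor `t`, express everything.
`exists_small_solution` replaces the weights by bounded ones satisfying the same inequalities: slack
variables turn the system into a zero-sum multiset of vectors, which splits into zero-sum blocks of
bounded size. Over the integers `t = 1`; over the rationals `t` absorbs unknown denominators; signs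
of weights are preserved, which serves the naturals.

The algorithm lists all triples of bounded height in a given dimension and keeps those agreeing with
the input on the initial segment. For minimization the dimensions are tried in increasing order. -/

/-! ### Zero-sum partitions and small solutions of integer inequalities -/

/-- An order of the elements of a zero-sum multiset of integers bounded by `a` along which all
partial sums are bounded by `a`. -/
theorem exists_list_partial_sums_le {α : Type*} (f : α → ℤ) (a : ℕ) (s : Multiset α)
    (hf : ∀ x ∈ s, |f x| ≤ a) (h0 : (s.map f).sum = 0) (k : ℕ) (hk : k ≤ s.card) :
    ∃ l : List α, l.length = k ∧ (l : Multiset α) ≤ s ∧ ∀ j, |((l.drop j).map f).sum| ≤ a := by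
  classical
  induction k with
  | zero => exact ⟨[], rfl, by simp, by simp⟩
  | succ k ih =>
    obtain ⟨l, hl, hls, hd⟩ := ih (by omega)
    have hsum : (l.map f).sum + ((s - (l : Multiset α)).map f).sum = 0 := by
      rw [← h0]
      conv_rhs => rw [← add_tsub_cancel_of_le hls]
      simp
    have hne : s - (l : Multiset α) ≠ 0 := by
      intro h
      have := Multiset.card_le_card (tsub_eq_zero_iff_le.1 h)
      simp only [Multiset.coe_card] at this
      omega
    have hl0 := hd 0
    simp only [List.drop_zero] at hl0
    -- An element of sign opposite to the current sum keeps the sum in `[-a, a]`. If there were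
    -- none, the remaining elements would all push the sum away from zero, against the total being
    -- zero.
    have key : ∃ x ∈ s - (l : Multiset α), |(l.map f).sum + f x| ≤ a := by
      by_contra! hcon
      by_cases hp : 0 < (l.map f).sum
      · have : 0 ≤ ((s - (l : Multiset α)).map f).sum := by
          apply Multiset.sum_nonneg
          intro y hy
          obtain ⟨x, hx, rfl⟩ := Multiset.mem_map.1 hy
          have h1 := hcon x hx
          have h2 := hf x (Multiset.mem_of_le tsub_le_self hx)
          rw [abs_le] at h2 hl0
          by_contra! h3
          exact absurd (abs_le.2 ⟨by omega, by omega⟩) (not_le.2 h1)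
        omega
      · obtain ⟨x, hx⟩ := Multiset.exists_mem_of_ne_zero hne
        have hneg : ∀ x ∈ s - (l : Multiset α), f x < 0 := by
          intro x hx
          have h1 := hcon x hx
          have h2 := hf x (Multiset.mem_of_le tsub_le_self hx)
          rw [abs_le] at h2 hl0
          by_contra! h3
          exact absurd (abs_le.2 ⟨by omega, by omega⟩) (not_le.2 h1)
        obtain ⟨u, hu⟩ := Multiset.exists_cons_of_mem hx
        rw [hu] at hneg hsum
        have h4 : (u.map f).sum ≤ 0 := by
          have : 0 ≤ (u.map (fun x => - f x)).sum := by
            apply Multiset.sum_nonneg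
            intro y hy
            obtain ⟨z, hz, rfl⟩ := Multiset.mem_map.1 hy
            have := hneg z (Multiset.mem_cons_of_mem hz)
            omega
          have h6 : (u.map (fun x => - f x)).sum = -(u.map f).sum := by simp
          omega
        have h5 := hneg x (Multiset.mem_cons_self _ _)
        simp only [Multiset.map_cons, Multiset.sum_cons] at hsum
        omega
    obtain ⟨x, hx, hxa⟩ := key
    refine ⟨x :: l, by simp [hl], ?_, ?_⟩
    -- The list grows at its head, so its partial sums are the sums of the suffixes `l.drop j`.
    · rw [← Multiset.cons_coe, ← Multiset.singleton_add]
      calc {x} + (l : Multiset α) ≤ (s - l) + l := by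
            gcongr
            exact Multiset.singleton_le.2 hx
        _ = s := tsub_add_cancel_of_le hls
    · rintro (_ | j)
      · simpa [add_comm] using hxa
      · simpa using hd j

/-- In the ordering above, `2 * a + 2` suffix sums take at most `2 * a + 1` values; the segment
between two equal ones has sum zero. -/
theorem exists_zero_sum_block {α : Type*} (f : α → ℤ) (a : ℕ) (s : Multiset α) (hs : s ≠ 0)
    (hf : ∀ x ∈ s, |f x| ≤ a) (h0 : (s.map f).sum = 0) :
    ∃ u ≤ s, u ≠ 0 ∧ u.card ≤ 2 * a + 1 ∧ (u.map f).sum = 0 := by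
  classical
  by_cases hc : s.card ≤ 2 * a + 1
  · exact ⟨s, le_rfl, hs, hc, h0⟩
  obtain ⟨l, hl, hls, hd⟩ := exists_list_partial_sums_le f a s hf h0 s.card le_rfl
  have hmap : ∀ j ∈ Finset.range (2 * a + 2),
      ((l.drop j).map f).sum ∈ Finset.Icc (-a : ℤ) a := by
    intro j _
    have := hd j
    rw [abs_le] at this
    simpa using this
  obtain ⟨i, hi, j, hj, hij, he⟩ := Finset.exists_ne_map_eq_of_card_lt_of_maps_to
    (by simp only [Int.card_Icc, Finset.card_range]; omega) hmap
  wlog hlt : i < j generalizing i j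
  · exact this j hj i hi hij.symm he.symm (by omega)
  simp only [Finset.mem_range] at hi hj
  refine ⟨((l.drop i).take (j - i) : List α), ?_, ?_, ?_, ?_⟩
  · refine le_trans ?_ hls
    exact ((List.take_sublist _ _).trans (List.drop_sublist _ _)).subperm
  · intro h
    have := congrArg Multiset.card h
    simp at this
    omega
  · simp; omega
  · have h1 : l.drop i = (l.drop i).take (j - i) ++ l.drop j := by
      conv_lhs => rw [← List.take_append_drop (j - i) (l.drop i)]
      rw [List.drop_drop]
      congr 2; omega
    have h2 := congrArg (fun l => (l.map f).sum) h1
    simp only [List.map_append, List.sum_append] at h2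
    rw [Multiset.map_coe, Multiset.sum_coe]
    omega

theorem exists_zero_sum_partition_of_int {α : Type*} (f : α → ℤ) (a : ℕ) (s : Multiset α)
    (hf : ∀ x ∈ s, |f x| ≤ a) (h0 : (s.map f).sum = 0) :
    ∃ P : Multiset (Multiset α), P.join = s ∧ ∀ u ∈ P, u.card ≤ 2 * a + 1 ∧ (u.map f).sum = 0 := by
  classical
  induction hn : s.card using Nat.strong_induction_on generalizing s with
  | _ n ih =>
    by_cases hs : s = 0
    · exact ⟨0, by simp [hs], by simp⟩
    obtain ⟨u, hu, hu0, huc, hus⟩ := exists_zero_sum_block f a s hs hf h0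
    have hcard : u.card + (s - u).card = s.card := by
      rw [← Multiset.card_add, add_tsub_cancel_of_le hu]
    have hupos : 0 < u.card := Multiset.card_pos.2 hu0
    obtain ⟨P, hP, hPu⟩ := ih (s - u).card (by omega) (s - u)
      (fun x hx => hf x (Multiset.mem_of_le tsub_le_self hx)) (by
        have : (u.map f).sum + ((s - u).map f).sum = 0 := by
          rw [← h0, ← Multiset.sum_add, ← Multiset.map_add, add_tsub_cancel_of_le hu]
        omega) rfl
    refine ⟨u ::ₘ P, by rw [Multiset.join_cons, hP, add_tsub_cancel_of_le hu], ?_⟩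
    intro w hw
    rcases Multiset.mem_cons.1 hw with rfl | hw
    · exact ⟨huc, hus⟩
    · exact hPu w hw

/-- The bound on the blocks of a zero-sum partition for `k` integer coordinates bounded by `a`. -/
def blockBound (a k : ℕ) : ℕ := Nat.rec 1 (fun _ L => (2 * (L * a) + 1) * L) k

theorem blockBound_succ (a k : ℕ) :
    blockBound a (k + 1) = (2 * (blockBound a k * a) + 1) * blockBound a k := rfl

theorem blockBound_mono (a : ℕ) : Monotone (blockBound a) :=
  monotone_nat_of_le_succ fun k => by
    rw [blockBound_succ]
    exact Nat.le_mul_of_pos_left _ (by omega)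

theorem abs_multiset_sum_le {α : Type*} (f : α → ℤ) (a : ℕ) (s : Multiset α)
    (hf : ∀ x ∈ s, |f x| ≤ a) : |(s.map f).sum| ≤ s.card * a := by
  induction s using Multiset.induction_on with
  | empty => simp
  | cons x s ih =>
    have h1 := ih fun y hy => hf y (Multiset.mem_cons_of_mem hy)
    have h2 := hf x (Multiset.mem_cons_self _ _)
    simp only [Multiset.map_cons, Multiset.sum_cons, Multiset.card_cons]
    push_cast
    have := abs_add_le (f x) (s.map f).sum
    linarith

theorem Multiset.join_map_join {α : Type*} (Q : Multiset (Multiset (Multiset α))) :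
    (Q.map Multiset.join).join = Q.join.join := by
  induction Q using Multiset.induction_on with
  | empty => simp
  | cons u Q ih => simp [ih]

/-- Induction on the coordinates. If blocks of size at most `L` have zero sums in the coordinates
`C`, their sums in a new coordinate `j` are bounded by `L * a`. The one-dimensional partition,
applied to the blocks as elements, groups at most `2 * (L * a) + 1` of them at a time. -/
theorem exists_zero_sum_partition {α ι : Type*} (v : α → ι → ℤ) (a : ℕ) (s : Multiset α)
    (hv : ∀ x ∈ s, ∀ i, |v x i| ≤ a) (C : Finset ι)
    (h0 : ∀ i ∈ C, (s.map (v · i)).sum = 0) :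
    ∃ P : Multiset (Multiset α), P.join = s ∧
      ∀ u ∈ P, u.card ≤ blockBound a C.card ∧ ∀ i ∈ C, (u.map (v · i)).sum = 0 := by
  classical
  induction C using Finset.induction_on with
  | empty =>
    refine ⟨s.map fun x => {x}, ?_, ?_⟩
    · simp [Multiset.join]
    · intro u hu
      obtain ⟨x, -, rfl⟩ := Multiset.mem_map.1 hu
      simp [blockBound]
  | insert j C hj ih =>
    obtain ⟨P, hP, hPu⟩ := ih fun i hi => h0 i (Finset.mem_insert_of_mem hi)
    have hmem : ∀ u ∈ P, ∀ x ∈ u, x ∈ s := fun u hu x hx => by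
      rw [← hP]; exact Multiset.mem_join.2 ⟨u, hu, hx⟩
    have hjoin : ∀ (R : Multiset (Multiset α)) (i : ι),
        (R.join.map (v · i)).sum = (R.map fun u => (u.map (v · i)).sum).sum := by
      intro R i
      induction R using Multiset.induction_on with
      | empty => simp
      | cons u R _ => simp
    obtain ⟨Q, hQ, hQu⟩ := exists_zero_sum_partition_of_int (fun u => (u.map (v · j)).sum)
      (blockBound a C.card * a) P (by
        intro u hu
        refine (abs_multiset_sum_le (v · j) a u fun x hx => hv x (hmem u hu x hx) j).trans ?_
        have := (hPu u hu).1
        push_cast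
        gcongr) (by rw [← hjoin, hP]; exact h0 j (Finset.mem_insert_self _ _))
    refine ⟨Q.map Multiset.join, by rw [Multiset.join_map_join, hQ, hP], ?_⟩
    intro w hw
    obtain ⟨R, hR, rfl⟩ := Multiset.mem_map.1 hw
    have hRP : ∀ u ∈ R, u ∈ P := fun u hu => by
      rw [← hQ]; exact Multiset.mem_join.2 ⟨R, hR, hu⟩
    refine ⟨?_, ?_⟩
    · rw [Finset.card_insert_of_notMem hj, blockBound_succ, Multiset.card_join]
      calc (R.map Multiset.card).sum ≤ (R.map Multiset.card).card • blockBound a C.card := by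
            apply Multiset.sum_le_card_nsmul
            intro c hc
            obtain ⟨u, hu, rfl⟩ := Multiset.mem_map.1 hc
            exact (hPu u (hRP u hu)).1
        _ ≤ _ := by
            rw [Multiset.card_map, smul_eq_mul]
            exact Nat.mul_le_mul_right _ (hQu R hR).1
    · intro i hi
      rw [hjoin]
      rcases Finset.mem_insert.1 hi with rfl | hi
      · exact (hQu R hR).2
      · apply Multiset.sum_eq_zero
        intro c hc
        obtain ⟨u, hu, rfl⟩ := Multiset.mem_map.1 hc
        exact (hPu u (hRP u hu)).2 i hi

/-- Small solutions: an integer vector `x` can be replaced by a vector `y` of bounded size which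
satisfies every homogeneous linear inequality with coefficients bounded by `H` that `x` satisfies,
and which is still positive at a prescribed coordinate. -/
theorem exists_small_solution {ι : Type*} [Fintype ι] (x : ι → ℤ) (H : ℕ) (t : ι) (ht : 0 < x t) :
    ∃ y : ι → ℤ,
      (∀ φ : ι → ℤ, (∀ d, |φ d| ≤ H) → ∑ d, φ d * x d ≤ 0 → ∑ d, φ d * y d ≤ 0) ∧
      0 < y t ∧ y t ≤ x t ∧
      ∀ d, |y d| ≤ blockBound (H + 1) ((2 * H + 1) ^ Fintype.card ι) := by
  classical
  -- All bounded forms satisfied by `x`: the finitely many constraints to be preserved.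
  let C : Finset (ι → ℤ) :=
    (Fintype.piFinset fun _ => Finset.Icc (-H : ℤ) H).filter fun φ => ∑ d, φ d * x d ≤ 0
  have hC : ∀ φ, φ ∈ C ↔ (∀ d, |φ d| ≤ H) ∧ ∑ d, φ d * x d ≤ 0 := by
    intro φ
    simp [C, abs_le]
  have hCcard : C.card ≤ (2 * H + 1) ^ Fintype.card ι := by
    refine (Finset.card_filter_le _ _).trans ?_
    rw [Fintype.card_piFinset, Finset.prod_const, Int.card_Icc, Finset.card_univ]
    apply le_of_eq; congr 1; omega
  -- `inl d` is one signed unit of `x d`, and `inr ψ` one unit of slack in the inequality `ψ`; the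
  -- coordinates of these vectors are the inequalities.
  let v : ι ⊕ (ι → ℤ) → (ι → ℤ) → ℤ := fun e φ =>
    match e with
    | .inl d => (x d).sign * φ d
    | .inr ψ => if ψ = φ then 1 else 0
  have hsum : ∀ (φ : ι → ℤ) (u : Multiset (ι ⊕ (ι → ℤ))), (u.map (v · φ)).sum =
      ∑ d, φ d * ((x d).sign * (u.count (Sum.inl d) : ℤ)) + (u.count (Sum.inr φ) : ℤ) := by
    intro φ u
    induction u using Multiset.induction_on with
    | empty => simp
    | cons e u ih =>
      rw [Multiset.map_cons, Multiset.sum_cons, ih]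
      rcases e with d | ψ
      · simp only [Multiset.count_cons, v, Sum.inl.injEq, reduceCtorEq, if_false, Nat.cast_add,
          Nat.cast_ite, mul_add, Finset.sum_add_distrib]
        simp [Finset.sum_ite_eq', Finset.mem_univ]
        ring
      · simp only [Multiset.count_cons, v, Sum.inr.injEq, reduceCtorEq, if_false]
        by_cases h : ψ = φ
        · simp [h]; ring
        · simp [h, Ne.symm h]
  -- The vector `x` together with its slacks, in unary. Every coordinate in `C` sums to zero.
  let s : Multiset (ι ⊕ (ι → ℤ)) :=
    ∑ d, (x d).natAbs • {Sum.inl d} + ∑ φ ∈ C, (∑ d, φ d * x d).natAbs • {Sum.inr φ}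
  have hsl : ∀ d, s.count (Sum.inl d) = (x d).natAbs := by
    intro d
    simp [s, Multiset.count_sum', Multiset.count_singleton]
  have hsr : ∀ φ ∈ C, s.count (Sum.inr φ) = (∑ d, φ d * x d).natAbs := by
    intro φ hφ
    simp [s, Multiset.count_sum', Multiset.count_singleton, hφ]
  let v' : ι ⊕ (ι → ℤ) → C → ℤ := fun e φ => v e φ
  obtain ⟨P, hP, hPu⟩ := exists_zero_sum_partition v' (H + 1) s (by
      rintro (d | ψ) - ⟨φ, hφ⟩
      · have h1 := ((hC φ).1 hφ).1 d
        have h2 : |(x d).sign| ≤ 1 := by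
          rcases lt_trichotomy (x d) 0 with h | h | h
          · simp [Int.sign_eq_neg_one_of_neg h]
          · simp [h]
          · simp [Int.sign_eq_one_of_pos h]
        simp only [v', v, abs_mul]
        push_cast
        nlinarith [abs_nonneg (φ d), abs_nonneg (x d).sign]
      · simp only [v', v]
        split_ifs
        · simp
        · rw [abs_zero]; positivity) Finset.univ (by
      rintro ⟨φ, hφ⟩ -
      simp only [v']
      rw [hsum φ s, hsr φ hφ, Int.natCast_natAbs, abs_of_nonpos ((hC φ).1 hφ).2]
      rw [add_neg_eq_zero]
      refine Finset.sum_congr rfl fun d _ => ?_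
      rw [hsl, Int.natCast_natAbs, Int.sign_mul_abs])
  have hts : Sum.inl t ∈ P.join := by
    rw [hP, ← Multiset.one_le_count_iff_mem, hsl]; omega
  -- A block containing a unit of `x t` has `y t > 0`. Being contained in `s`, it has `y t ≤ x t`,
  -- and its slack counts are nonnegative, which is the inequalities for `y`.
  obtain ⟨u, huP, htu⟩ := Multiset.mem_join.1 hts
  have hus : u ≤ s := by rw [← hP]; exact Multiset.le_sum_of_mem huP
  have hucard : u.card ≤ blockBound (H + 1) ((2 * H + 1) ^ Fintype.card ι) := by
    refine (hPu u huP).1.trans (blockBound_mono _ ?_)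
    simpa using hCcard
  refine ⟨fun d => (x d).sign * (u.count (Sum.inl d) : ℤ), ?_, ?_, ?_, ?_⟩
  · intro φ h1 h2
    have hφ : φ ∈ C := (hC φ).2 ⟨h1, h2⟩
    have h3 := (hPu u huP).2 ⟨φ, hφ⟩ (Finset.mem_univ _)
    simp only [v'] at h3
    rw [hsum φ u] at h3
    have : (0 : ℤ) ≤ u.count (Sum.inr φ) := Int.natCast_nonneg _
    linarith
  · have := Multiset.one_le_count_iff_mem.2 htu
    simp only [Int.sign_eq_one_of_pos ht]
    omega
  · have := Multiset.count_le_of_le (Sum.inl t) hus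
    rw [hsl] at this
    simp only [Int.sign_eq_one_of_pos ht]
    omega
  · intro d
    have h1 := Multiset.count_le_card (Sum.inl d) u
    have h2 : |(x d).sign| ≤ 1 := by
      rcases lt_trichotomy (x d) 0 with h | h | h
      · simp [Int.sign_eq_neg_one_of_neg h]
      · simp [h]
      · simp [Int.sign_eq_one_of_pos h]
    rw [abs_mul, Nat.abs_cast]
    have h3 : (u.count (Sum.inl d) : ℤ) ≤ blockBound (H + 1) ((2 * H + 1) ^ Fintype.card ι) := by
      exact_mod_cast h1.trans hucard
    nlinarith [abs_nonneg (x d).sign, Int.natCast_nonneg (u.count (Sum.inl d))]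

/-! ### Walks up to edge multiplicities, and pumping -/

/-- The length of a walk with edge multiplicities `z`. -/
abbrev edgeCount {V : Type*} [Fintype V] (z : V × V → ℕ) : ℕ := ∑ e, z e

theorem edgeCount_add {V : Type*} [Fintype V] (z z' : V × V → ℕ) :
    edgeCount (z + z') = edgeCount z + edgeCount z' := by
  simp [edgeCount, Finset.sum_add_distrib]

theorem edgeCount_nsmul {V : Type*} [Fintype V] (q : ℕ) (z : V × V → ℕ) :
    edgeCount (q • z) = q * edgeCount z := by
  simp [edgeCount, Finset.mul_sum]

/-- `EdgeWalk R i j U z`: some walk from `i` to `j` along `R` has set of vertices `U` and edge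
multiplicities `z`. -/
inductive EdgeWalk {V : Type*} [DecidableEq V] (R : V → V → Prop) :
    V → V → Finset V → (V × V → ℕ) → Prop
  | nil (i : V) : EdgeWalk R i i {i} 0
  | cons {i j k : V} {U : Finset V} {z : V × V → ℕ} (h : R i j) (w : EdgeWalk R j k U z) :
      EdgeWalk R i k (insert i U) (Pi.single (i, j) 1 + z)

namespace EdgeWalk

variable {V : Type*} [DecidableEq V] {R : V → V → Prop}

theorem append {i v j : V} {U U' : Finset V} {z z' : V × V → ℕ} (h : EdgeWalk R i v U z)
    (h' : EdgeWalk R v j U' z') : EdgeWalk R i j (U ∪ U') (z + z') := by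
  induction h with
  | nil i =>
    have : {i} ∪ U' = U' := by
      apply Finset.union_eq_right.2
      cases h' <;> simp
    rwa [this, zero_add]
  | cons hR _ ih =>
    rw [Finset.insert_union, add_assoc]
    exact cons hR (ih h')

theorem split {i j v : V} {U : Finset V} {z : V × V → ℕ} (h : EdgeWalk R i j U z) (hv : v ∈ U) :
    ∃ U₁ U₂ z₁ z₂, U = U₁ ∪ U₂ ∧ z = z₁ + z₂ ∧ EdgeWalk R i v U₁ z₁ ∧ EdgeWalk R v j U₂ z₂ := by
  induction h with
  | nil i =>
    rw [Finset.mem_singleton] at hv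
    subst hv
    exact ⟨_, _, _, _, (Finset.union_self _).symm, (add_zero 0).symm, nil v, nil v⟩
  | @cons i j k U z hR w ih =>
    by_cases hvi : v = i
    · subst hvi
      refine ⟨{v}, insert v U, 0, _, ?_, (zero_add _).symm, nil v, cons hR w⟩
      ext; simp
    · obtain ⟨U₁, U₂, z₁, z₂, rfl, rfl, h₁, h₂⟩ := ih (Finset.mem_of_mem_insert_of_ne hv hvi)
      exact ⟨_, U₂, _, z₂, (Finset.insert_union _ _ _).symm, (add_assoc _ _ _).symm,
        cons hR h₁, h₂⟩

theorem of_function (w : ℕ → V) (a k : ℕ) (hw : ∀ t, a ≤ t → t < a + k → R (w t) (w (t + 1))) :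
    EdgeWalk R (w a) (w (a + k)) ((Finset.Icc a (a + k)).image w)
      (∑ t ∈ Finset.Ico a (a + k), Pi.single (w t, w (t + 1)) 1) := by
  induction k generalizing a with
  | zero => simpa using nil (R := R) (w a)
  | succ k ih =>
    have h := ih (a + 1) fun t h₁ h₂ => hw t (by omega) (by omega)
    have e : a + 1 + k = a + (k + 1) := by omega
    rw [e] at h
    rw [Finset.sum_eq_sum_Ico_succ_bot (by omega)]
    have hI : (Finset.Icc a (a + (k + 1))).image w =
        insert (w a) ((Finset.Icc (a + 1) (a + (k + 1))).image w) := by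
      rw [← Finset.image_insert, Finset.insert_Icc_add_one_left_eq_Icc (by omega)]
    rw [hI]
    exact cons (hw a le_rfl (by omega)) h

theorem exists_function {i j : V} {U : Finset V} {z : V × V → ℕ} (h : EdgeWalk R i j U z) :
    ∃ (w : ℕ → V) (k : ℕ), w 0 = i ∧ w k = j ∧ (∀ t < k, R (w t) (w (t + 1))) ∧
      U = (Finset.Icc 0 k).image w ∧
      z = ∑ t ∈ Finset.Ico 0 k, Pi.single (w t, w (t + 1)) 1 := by
  induction h with
  | nil i => exact ⟨fun _ => i, 0, by simp⟩
  | @cons i j l U z hR _ ih =>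
    obtain ⟨w, k, h0, hk, hw, hU, hz⟩ := ih
    refine ⟨fun t => if t = 0 then i else w (t - 1), k + 1, by simp, by simpa using hk, ?_, ?_, ?_⟩
    · rintro (_ | t) ht
      · simpa [h0] using hR
      · simpa using hw t (by omega)
    · rw [← Finset.insert_Icc_add_one_left_eq_Icc (by omega), Finset.image_insert, hU]
      congr 1
      ext v
      simp only [Finset.mem_image, Finset.mem_Icc]
      constructor
      · rintro ⟨t, ht, rfl⟩
        exact ⟨t + 1, by omega, by simp⟩
      · rintro ⟨t, ht, rfl⟩
        exact ⟨t - 1, by omega, by rw [if_neg (by omega)]⟩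
    · rw [Finset.sum_eq_sum_Ico_succ_bot (by omega), ← Finset.sum_Ico_add' _ 0 k 1, hz]
      simp [h0]

/-- A closed walk inside `U`, with edge multiplicities `c`. -/
def Loop (R : V → V → Prop) (U : Finset V) (c : V × V → ℕ) : Prop :=
  ∃ v ∈ U, ∃ U' ⊆ U, EdgeWalk R v v U' c

/-- The walk is cut at the base point of the loop. Since the loop stays inside `U`, the vertex set
does not change, so loops can be inserted repeatedly and in any order. -/
theorem insert_loop {i j : V} {U : Finset V} {z c : V × V → ℕ} (h : EdgeWalk R i j U z)
    (hc : Loop R U c) : EdgeWalk R i j U (z + c) := by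
  obtain ⟨v, hv, U', hU', hc⟩ := hc
  obtain ⟨U₁, U₂, z₁, z₂, rfl, rfl, h₁, h₂⟩ := h.split hv
  have := h₁.append (hc.append h₂)
  convert this using 1
  · ext x
    have := @hU' x
    simp only [Finset.mem_union] at this ⊢
    tauto
  · abel

theorem Loop.nsmul {U : Finset V} {c : V × V → ℕ} (hc : Loop R U c) (q : ℕ) :
    Loop R U (q • c) := by
  obtain ⟨v, hv, U', hU', hc⟩ := hc
  rcases q with _ | q
  · exact ⟨v, hv, {v}, by simpa using hv, by simpa using nil (R := R) v⟩
  · refine ⟨v, hv, U', hU', ?_⟩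
    induction q with
    | zero => simpa using hc
    | succ q ih =>
      rw [succ_nsmul]
      simpa using ih.append hc

theorem insert_loops {i j : V} {U : Finset V} {z : V × V → ℕ} (h : EdgeWalk R i j U z)
    (m : Multiset (V × V → ℕ)) (hm : ∀ c ∈ m, Loop R U c) : EdgeWalk R i j U (z + m.sum) := by
  induction m using Multiset.induction_on with
  | empty => simpa using h
  | cons c m ih =>
    have := (ih fun x hx => hm x (Multiset.mem_cons_of_mem hx)).insert_loop
      (hm c (Multiset.mem_cons_self _ _))
    rwa [add_assoc, add_comm m.sum, ← Multiset.sum_cons] at this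

variable [Fintype V]

theorem edgeCount_sum_single (w : ℕ → V) (s : Finset ℕ) :
    edgeCount (∑ t ∈ s, Pi.single (w t, w (t + 1)) 1) = s.card := by
  simp only [edgeCount, Finset.sum_apply]
  rw [Finset.sum_comm]
  simp

/-- A long walk contains a short closed subwalk whose removal keeps the set of vertices. -/
theorem exists_removable_loop {n : ℕ} (hn : Fintype.card V ≤ n) {i j : V} {U : Finset V}
    {z : V × V → ℕ} (h : EdgeWalk R i j U z) (hz : (n + 1) ^ 2 < edgeCount z) :
    ∃ z' c, z = z' + c ∧ EdgeWalk R i j U z' ∧ Loop R U c ∧ 0 < edgeCount c ∧ edgeCount c ≤ n := by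
  obtain ⟨w, k, rfl, rfl, hw, hU, rfl⟩ := h.exists_function
  rw [edgeCount_sum_single, Nat.card_Ico, Nat.sub_zero] at hz
  -- The walk contains `n + 1` disjoint windows of `n + 1` positions. Each window repeats a vertex,
  -- which gives a closed subwalk with at most `n` edges.
  have hblock : ∀ b, ∃ s t, b * (n + 1) ≤ s ∧ s < t ∧ t < (b + 1) * (n + 1) ∧ w s = w t := by
    intro b
    obtain ⟨s, hs, t, ht, hst, he⟩ := Finset.exists_ne_map_eq_of_card_lt_of_maps_to
      (s := Finset.Ico (b * (n + 1)) ((b + 1) * (n + 1))) (t := (Finset.univ : Finset V)) (f := w)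
      (by rw [Nat.card_Ico, Finset.card_univ, ← Nat.sub_mul]; simp; omega) (by simp)
    rw [Finset.mem_Ico] at hs ht
    rcases Nat.lt_or_gt_of_ne hst with hlt | hlt
    · exact ⟨s, t, hs.1, hlt, ht.2, he⟩
    · exact ⟨t, s, ht.1, hlt, hs.2, he.symm⟩
  choose s t hs hst ht he using hblock
  have htk : ∀ b ≤ n, t b < k := by
    intro b hb
    have h1 := ht b
    have h2 : (b + 1) * (n + 1) ≤ (n + 1) ^ 2 := by
      rw [pow_two]; exact Nat.mul_le_mul_right _ (by omega)
    omega
  -- Otherwise each of the `n + 1` closed subwalks visits a vertex found nowhere else on the walk.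
  -- These vertices are distinct, and there are at most `n` vertices.
  have hgood : ∃ b ≤ n, ∀ u, s b ≤ u → u < t b → ∃ q ≤ k, (q < s b ∨ t b ≤ q) ∧ w q = w u := by
    by_contra! hcon
    choose! u hu using hcon
    obtain ⟨b, hb, b', hb', hne, hbb⟩ := Finset.exists_ne_map_eq_of_card_lt_of_maps_to
      (s := Finset.range (n + 1)) (t := (Finset.univ : Finset V)) (f := fun b => w (u b))
      (by rw [Finset.card_univ, Finset.card_range]; omega) (by simp)
    wlog hlt : b < b' generalizing b b'
    · exact this b' hb' b hb hne.symm hbb.symm (by omega)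
    simp only [Finset.mem_range] at hb hb'
    have h1 := hu b (by omega)
    have h2 := hu b' (by omega)
    have h3 := htk b' (by omega)
    have h4 : (b + 1) * (n + 1) ≤ b' * (n + 1) := Nat.mul_le_mul_right _ hlt
    have h5 := ht b
    have h6 := hs b'
    exact h1.2.2 (u b') (by omega) (Or.inr (by omega)) hbb.symm
  obtain ⟨b, hb, hcov⟩ := hgood
  have hsb := hs b
  have hstb := hst b
  have htb := ht b
  have htkb := htk b hb
  have heb := he b
  generalize s b = s at *
  generalize t b = t at *
  have w1 := of_function (R := R) w 0 s fun r _ hr => hw r (by omega)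
  have w2 := of_function (R := R) w s (t - s) fun r _ hr => hw r (by omega)
  have w3 := of_function (R := R) w t (k - t) fun r _ hr => hw r (by omega)
  rw [zero_add] at w1
  rw [show s + (t - s) = t by omega] at w2
  rw [show t + (k - t) = k by omega] at w3
  rw [← heb] at w2 w3
  refine ⟨(∑ r ∈ Finset.Ico 0 s, Pi.single (w r, w (r + 1)) 1) +
      ∑ r ∈ Finset.Ico t k, Pi.single (w r, w (r + 1)) 1, _, ?_, ?_, ⟨w s, ?_, _, ?_, w2⟩, ?_, ?_⟩
  · rw [← Finset.sum_Ico_consecutive _ (Nat.zero_le s) (by omega : s ≤ k),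
      ← Finset.sum_Ico_consecutive _ (by omega : s ≤ t) (by omega : t ≤ k)]
    rw [add_assoc]; congr 1; rw [add_comm]
  · convert w1.append w3 using 1
    rw [hU]
    ext v
    simp only [Finset.mem_image, Finset.mem_union, Finset.mem_Icc]
    constructor
    · rintro ⟨r, hr, rfl⟩
      by_cases hr' : s ≤ r ∧ r < t
      · obtain ⟨q, hq, hq', hqr⟩ := hcov r hr'.1 hr'.2
        rcases hq' with hq' | hq'
        · exact Or.inl ⟨q, by omega, hqr⟩
        · exact Or.inr ⟨q, by omega, hqr⟩
      · by_cases hr2 : r < s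
        · exact Or.inl ⟨r, by omega, rfl⟩
        · exact Or.inr ⟨r, by omega, rfl⟩
    · rintro (⟨r, hr, rfl⟩ | ⟨r, hr, rfl⟩)
      · exact ⟨r, by omega, rfl⟩
      · exact ⟨r, by omega, rfl⟩
  · rw [hU]
    exact Finset.mem_image_of_mem _ (Finset.mem_Icc.2 ⟨by omega, by omega⟩)
  · rw [hU]
    exact Finset.image_subset_image (Finset.Icc_subset_Icc (by omega) (by omega))
  · rw [edgeCount_sum_single, Nat.card_Ico]; omega
  · rw [edgeCount_sum_single, Nat.card_Ico]
    rw [add_mul] at htb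
    omega

/-- Every removal keeps the vertex set `U`, so all removed loops remain attachable to the short walk
that is left. -/
theorem exists_loop_decomposition {n : ℕ} (hn : Fintype.card V ≤ n) {i j : V} {U : Finset V}
    {z : V × V → ℕ} (h : EdgeWalk R i j U z) :
    ∃ z₀ m, z = z₀ + Multiset.sum m ∧ EdgeWalk R i j U z₀ ∧ edgeCount z₀ ≤ (n + 1) ^ 2 ∧
      ∀ c ∈ m, Loop R U c ∧ 0 < edgeCount c ∧ edgeCount c ≤ n := by
  induction hl : edgeCount z using Nat.strong_induction_on generalizing z with
  | _ l ih =>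
    by_cases hz : edgeCount z ≤ (n + 1) ^ 2
    · exact ⟨z, 0, by simp, h, hz, by simp⟩
    obtain ⟨z', c, rfl, hz', hc, hc0, hcn⟩ := h.exists_removable_loop hn (by omega)
    rw [edgeCount_add] at hl
    obtain ⟨z₀, m, rfl, h0, h0', hm⟩ := ih (edgeCount z') (by omega) hz' rfl
    refine ⟨z₀, c ::ₘ m, by rw [Multiset.sum_cons]; abel, h0, h0', ?_⟩
    intro x hx
    rcases Multiset.mem_cons.1 hx with rfl | hx
    · exact ⟨hc, hc0, hcn⟩
    · exact hm x hx

/-- Walks in graphs with at most `n` vertices that are longer than this contain a loop of length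
`n !` that can be removed. -/
def pumpLength (n : ℕ) : ℕ := (n + 1) ^ 2 + n * ((n + 1) ^ (n * n) * n.factorial)

/-- A loop of length at most `n` has edge multiplicities at most `n`, so there are at most `(n + 1)
^ (n * n)` of them. In a walk longer than `pumpLength n` some removable loop occurs `n !` times. Its
length divides `n !`, and the right number of copies has length exactly `n !`. -/
theorem exists_pump {n : ℕ} (hn : Fintype.card V ≤ n) {i j : V} {U : Finset V}
    {z : V × V → ℕ} (h : EdgeWalk R i j U z) (hz : pumpLength n < edgeCount z) :
    ∃ z' σ, z = z' + σ ∧ EdgeWalk R i j U z' ∧ Loop R U σ ∧ edgeCount σ = n.factorial := by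
  obtain ⟨z₀, m, rfl, h0, h0', hm⟩ := h.exists_loop_decomposition hn
  have hex : ∃ c ∈ m, n.factorial ≤ m.count c := by
    by_contra! hcon
    have hdist : m.toFinset.card ≤ (n + 1) ^ (n * n) := by
      have hsub : m.toFinset ⊆ Fintype.piFinset fun _ => Finset.range (n + 1) := by
        intro c hc
        rw [Fintype.mem_piFinset]
        intro e
        have h1 := (hm c (Multiset.mem_toFinset.1 hc)).2.2
        have h2 : c e ≤ edgeCount c := Finset.single_le_sum (by simp) (Finset.mem_univ e)
        rw [Finset.mem_range]; omega
      refine (Finset.card_le_card hsub).trans ?_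
      rw [Fintype.card_piFinset, Finset.prod_const, Finset.card_range, Finset.card_univ,
        Fintype.card_prod]
      exact Nat.pow_le_pow_right (by omega) (Nat.mul_le_mul hn hn)
    have hcard : m.card ≤ (n + 1) ^ (n * n) * n.factorial := by
      rw [← Multiset.toFinset_sum_count_eq]
      calc ∑ c ∈ m.toFinset, m.count c ≤ m.toFinset.card • n.factorial :=
            Finset.sum_le_card_nsmul _ _ _ fun c hc => (hcon c (Multiset.mem_toFinset.1 hc)).le
        _ ≤ _ := by rw [smul_eq_mul]; exact Nat.mul_le_mul_right _ hdist
    have hlen : edgeCount m.sum ≤ n * m.card := by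
      clear hcon hdist hcard h hz
      induction m using Multiset.induction_on with
      | empty => simp [edgeCount]
      | cons c m ih =>
        have h1 := ih fun x hx => hm x (Multiset.mem_cons_of_mem hx)
        have h2 := (hm c (Multiset.mem_cons_self _ _)).2.2
        rw [Multiset.sum_cons, edgeCount_add, Multiset.card_cons, mul_add]
        omega
    rw [edgeCount_add, pumpLength] at hz
    have := Nat.mul_le_mul_left n hcard
    omega
  obtain ⟨c, hcm, hc⟩ := hex
  obtain ⟨hcl, hc0, hcn⟩ := hm c hcm
  have hle : Multiset.replicate (n.factorial / edgeCount c) c ≤ m :=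
    Multiset.le_count_iff_replicate_le.1 ((Nat.div_le_self _ _).trans hc)
  refine ⟨z₀ + (m - Multiset.replicate (n.factorial / edgeCount c) c).sum,
    (n.factorial / edgeCount c) • c, ?_, ?_, hcl.nsmul _, ?_⟩
  · rw [← Multiset.sum_replicate, add_assoc, ← Multiset.sum_add, tsub_add_cancel_of_le hle]
  · exact h0.insert_loops _ fun x hx => (hm x (Multiset.mem_of_le tsub_le_self hx)).1
  · rw [edgeCount_nsmul]
    exact Nat.div_mul_cancel (Nat.dvd_factorial hc0 hcn)

/-- The parameter `K` stops the pumping early enough for the remaining walk to have length at least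
`K`. With `K` the start of the cyclic regime, loops are removed only where `S` is geometric. -/
theorem exists_pump_decomposition {n : ℕ} (hn : Fintype.card V ≤ n) (K : ℕ) {i j : V}
    {U : Finset V} {z : V × V → ℕ} (h : EdgeWalk R i j U z) :
    ∃ z₀ m, z = z₀ + Multiset.sum m ∧ EdgeWalk R i j U z₀ ∧
      edgeCount z₀ ≤ pumpLength n + n.factorial + K ∧ (m = 0 ∨ K ≤ edgeCount z₀) ∧
      ∀ σ ∈ m, Loop R U σ ∧ edgeCount σ = n.factorial := by
  induction hl : edgeCount z using Nat.strong_induction_on generalizing z with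
  | _ l ih =>
    by_cases hz : edgeCount z ≤ pumpLength n + n.factorial + K
    · exact ⟨z, 0, by simp, h, hz, by simp, by simp⟩
    obtain ⟨z', σ, rfl, hz', hσ, hσn⟩ := h.exists_pump hn (by omega)
    have hpos := n.factorial_pos
    rw [edgeCount_add] at hl hz
    obtain ⟨z₀, m, rfl, h0, h0', h0K, hm⟩ := ih (edgeCount z') (by omega) hz' rfl
    refine ⟨z₀, σ ::ₘ m, by rw [Multiset.sum_cons]; abel, h0, h0', Or.inr ?_, ?_⟩
    · rcases h0K with rfl | h0K
      · simp only [Multiset.sum_zero, add_zero] at hz; omega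
      · exact h0K
    · intro x hx
      rcases Multiset.mem_cons.1 hx with rfl | hx
      · exact ⟨hσ, hσn⟩
      · exact hm x hx

end EdgeWalk

/-! ### The min-plus semiring of integers -/

/-- The min-plus semiring of integers. -/
abbrev Zmin : Type := Tropical (WithTop ℤ)

namespace Zmin

/-- The finite element of `Zmin` given by an integer. -/
def ofInt (m : ℤ) : Zmin := Tropical.trop (m : WithTop ℤ)

/-- The integer given by a finite element of `Zmin`, and `0` for `∞`. -/
def toInt (x : Zmin) : ℤ := (Tropical.untrop x).untopD 0

theorem ofInt_ne_zero (m : ℤ) : ofInt m ≠ 0 := fun h => by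
  have : ((m : ℤ) : WithTop ℤ) = ⊤ := congrArg Tropical.untrop h
  exact WithTop.coe_ne_top this

theorem toInt_ofInt (m : ℤ) : toInt (ofInt m) = m := rfl

theorem toInt_zero : toInt 0 = 0 := rfl

theorem ofInt_toInt {x : Zmin} (h : x ≠ 0) : ofInt (toInt x) = x := by
  induction x using Tropical.tropRec with
  | h x =>
    induction x using WithTop.recTopCoe with
    | top => exact absurd rfl h
    | coe m => rfl

theorem exists_eq_ofInt {x : Zmin} (h : x ≠ 0) : ∃ m, x = ofInt m := ⟨_, (ofInt_toInt h).symm⟩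

theorem ofInt_add (m m' : ℤ) : ofInt (m + m') = ofInt m * ofInt m' := rfl

theorem ofInt_injective : Function.Injective ofInt := fun m m' h => by
  exact congrArg toInt h

theorem ofInt_zero : ofInt 0 = 1 := rfl

theorem ofInt_pow (m : ℤ) (t : ℕ) : ofInt m ^ t = ofInt (t * m) := by
  induction t with
  | zero => simp [ofInt_zero]
  | succ t ih => rw [pow_succ, ih, ← ofInt_add]; congr 1; push_cast; ring

theorem ofInt_le_ofInt {m m' : ℤ} : ofInt m ≤ ofInt m' ↔ m ≤ m' := by
  rw [← Tropical.untrop_le_iff]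
  exact WithTop.coe_le_coe

theorem ne_zero_of_le_ofInt {x : Zmin} {m : ℤ} (h : x ≤ ofInt m) : x ≠ 0 := by
  rintro rfl
  exact ofInt_ne_zero m (le_antisymm (Tropical.le_zero _) h)

theorem sum_le {ι : Type*} (s : Finset ι) (f : ι → Zmin) {i : ι} (hi : i ∈ s) :
    ∑ i ∈ s, f i ≤ f i := by
  classical
  rw [← Finset.add_sum_erase s f hi, ← Tropical.untrop_le_iff, Tropical.untrop_add]
  exact min_le_left _ _

theorem exists_sum_eq {ι : Type*} (s : Finset ι) (f : ι → Zmin) (h : ∑ i ∈ s, f i ≠ 0) :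
    ∃ i ∈ s, ∑ i ∈ s, f i = f i := by
  classical
  induction s using Finset.induction_on with
  | empty => simp at h
  | insert a s ha ih =>
    rw [Finset.sum_insert ha] at h ⊢
    rcases le_total (f a) (∑ i ∈ s, f i) with hle | hle
    · exact ⟨a, Finset.mem_insert_self _ _, Tropical.add_eq_left hle⟩
    · rw [Tropical.add_eq_right hle] at h ⊢
      obtain ⟨i, hi, h'⟩ := ih h
      exact ⟨i, Finset.mem_insert_of_mem hi, h'⟩

end Zmin

/-! ### Recognized sequences as minimal weights of runs -/

namespace Realization

variable {N : ℕ}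

theorem recognizes_iff {K : Type} [CommSemiring K] (r : Realization K N) (S : ℕ → K) :
    r.Recognizes S ↔ ∀ k, S k = ∑ i, ∑ j, r.c i * ((r.A ^ k) i j * r.b j) := by
  simp only [Recognizes, dotProduct, Matrix.mulVec, Finset.mul_sum]

/-- The edges of finite weight. -/
def Edge (r : Realization Zmin N) (i j : Fin N) : Prop := r.A i j ≠ 0

/-- The weight of an edge multiset. -/
def edgeWeight (r : Realization Zmin N) (z : Fin N × Fin N → ℕ) : ℤ :=
  ∑ e, (z e : ℤ) * (r.A e.1 e.2).toInt

theorem edgeWeight_add (r : Realization Zmin N) (z z' : Fin N × Fin N → ℕ) :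
    r.edgeWeight (z + z') = r.edgeWeight z + r.edgeWeight z' := by
  simp [edgeWeight, add_mul, Finset.sum_add_distrib]

theorem edgeWeight_single (r : Realization Zmin N) (i j : Fin N) :
    r.edgeWeight (Pi.single (i, j) 1) = (r.A i j).toInt := by
  rw [edgeWeight, Finset.sum_eq_single (i, j)]
  · simp
  · intro e _ he
    simp [he]
  · simp

theorem edgeWeight_sum (r : Realization Zmin N) (m : Multiset (Fin N × Fin N → ℕ)) :
    r.edgeWeight m.sum = (m.map r.edgeWeight).sum := by
  induction m using Multiset.induction_on with
  | empty => simp [edgeWeight]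
  | cons c m ih => simp [edgeWeight_add, ih]

theorem edgeWeight_nsmul (r : Realization Zmin N) (q : ℕ) (z : Fin N × Fin N → ℕ) :
    r.edgeWeight (q • z) = q * r.edgeWeight z := by
  simp [edgeWeight, Finset.mul_sum, mul_assoc]

/-- An accepting run from `i` to `j` with edge multiplicities `z` and set of vertices `U`. -/
def Run (r : Realization Zmin N) (i j : Fin N) (U : Finset (Fin N))
    (z : Fin N × Fin N → ℕ) : Prop :=
  r.c i ≠ 0 ∧ r.b j ≠ 0 ∧ EdgeWalk r.Edge i j U z

/-- The weight of an accepting run. -/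
def runWeight (r : Realization Zmin N) (i j : Fin N) (z : Fin N × Fin N → ℕ) : ℤ :=
  (r.c i).toInt + r.edgeWeight z + (r.b j).toInt

theorem runWeight_add (r : Realization Zmin N) (i j : Fin N) (z z' : Fin N × Fin N → ℕ) :
    r.runWeight i j (z + z') = r.runWeight i j z + r.edgeWeight z' := by
  rw [runWeight, runWeight, edgeWeight_add]; ring

/-- With `exists_edgeWalk_of_pow_ne_zero` this identifies the entries of `A ^ k` with the minimal
weights of walks of length `k`. -/
theorem pow_le_of_edgeWalk {r : Realization Zmin N} {i j : Fin N} {U : Finset (Fin N)}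
    {z : Fin N × Fin N → ℕ} (h : EdgeWalk r.Edge i j U z) :
    (r.A ^ edgeCount z) i j ≤ Zmin.ofInt (r.edgeWeight z) := by
  induction h with
  | nil i => simp [edgeCount, edgeWeight, Zmin.ofInt_zero]
  | @cons i j k U z hR w ih =>
    have : edgeCount (Pi.single (i, j) 1 + z) = edgeCount z + 1 := by
      rw [edgeCount_add, add_comm]; congr 1; simp [edgeCount]
    rw [this, pow_succ', Matrix.mul_apply, edgeWeight_add, edgeWeight_single, Zmin.ofInt_add,
      Zmin.ofInt_toInt hR]
    refine (Zmin.sum_le _ _ (Finset.mem_univ j)).trans ?_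
    gcongr

theorem exists_edgeWalk_of_pow_ne_zero (r : Realization Zmin N) (k : ℕ) (i j : Fin N)
    (h : (r.A ^ k) i j ≠ 0) : ∃ U z, EdgeWalk r.Edge i j U z ∧ edgeCount z = k ∧
      (r.A ^ k) i j = Zmin.ofInt (r.edgeWeight z) := by
  induction k generalizing i with
  | zero =>
    rw [pow_zero] at h ⊢
    have hij : i = j := by
      by_contra hij
      exact h (Matrix.one_apply_ne hij)
    subst hij
    exact ⟨_, _, .nil i, by simp [edgeCount], by simp [edgeWeight, Zmin.ofInt_zero]⟩
  | succ k ih =>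
    rw [pow_succ', Matrix.mul_apply] at h ⊢
    obtain ⟨l, -, hl⟩ := Zmin.exists_sum_eq _ _ h
    rw [hl] at h ⊢
    have hA : r.A i l ≠ 0 := left_ne_zero_of_mul h
    obtain ⟨U, z, hw, hz, he⟩ := ih l (right_ne_zero_of_mul h)
    refine ⟨_, _, .cons hA hw, ?_, ?_⟩
    · rw [edgeCount_add, hz, add_comm]; simp [edgeCount]
    · rw [he, edgeWeight_add, edgeWeight_single, Zmin.ofInt_add, Zmin.ofInt_toInt hA]

theorem Recognizes.le_runWeight {r : Realization Zmin N} {S : ℕ → Zmin} (h : r.Recognizes S)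
    {i j : Fin N} {U : Finset (Fin N)} {z : Fin N × Fin N → ℕ} (hr : r.Run i j U z) :
    S (edgeCount z) ≤ Zmin.ofInt (r.runWeight i j z) := by
  obtain ⟨hc, hb, hw⟩ := hr
  rw [(r.recognizes_iff S).1 h, runWeight, add_assoc, Zmin.ofInt_add, Zmin.ofInt_add,
    Zmin.ofInt_toInt hc, Zmin.ofInt_toInt hb]
  refine (Zmin.sum_le _ _ (Finset.mem_univ i)).trans
    ((Zmin.sum_le _ _ (Finset.mem_univ j)).trans ?_)
  gcongr
  exact pow_le_of_edgeWalk hw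

theorem Recognizes.exists_run {r : Realization Zmin N} {S : ℕ → Zmin} (h : r.Recognizes S)
    {k : ℕ} (hk : S k ≠ 0) : ∃ i j U z, r.Run i j U z ∧ edgeCount z = k ∧
      S k = Zmin.ofInt (r.runWeight i j z) := by
  rw [(r.recognizes_iff S).1 h] at hk ⊢
  obtain ⟨i, -, hi⟩ := Zmin.exists_sum_eq _ _ hk
  rw [hi] at hk ⊢
  obtain ⟨j, -, hj⟩ := Zmin.exists_sum_eq _ _ hk
  rw [hj] at hk ⊢
  have h2 := right_ne_zero_of_mul hk
  obtain ⟨U, z, hw, hz, he⟩ := r.exists_edgeWalk_of_pow_ne_zero k i j (left_ne_zero_of_mul h2)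
  refine ⟨i, j, U, z, ⟨left_ne_zero_of_mul hk, right_ne_zero_of_mul h2, hw⟩, hz, ?_⟩
  rw [he, runWeight, add_assoc, Zmin.ofInt_add, Zmin.ofInt_add,
    Zmin.ofInt_toInt (left_ne_zero_of_mul hk), Zmin.ofInt_toInt (right_ne_zero_of_mul h2)]

/-- The sequence recognized by a triple is the minimum of the weights of its runs. -/
theorem recognizes_of_run {r : Realization Zmin N} {S : ℕ → Zmin}
    (hle : ∀ i j U z, r.Run i j U z → S (edgeCount z) ≤ Zmin.ofInt (r.runWeight i j z))
    (hex : ∀ k, S k ≠ 0 → ∃ i j U z, r.Run i j U z ∧ edgeCount z = k ∧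
      Zmin.ofInt (r.runWeight i j z) ≤ S k) : r.Recognizes S := by
  have h0 : r.Recognizes fun k => r.c ⬝ᵥ (r.A ^ k *ᵥ r.b) := fun k => rfl
  intro k
  apply le_antisymm
  · by_cases hk : r.c ⬝ᵥ (r.A ^ k *ᵥ r.b) = 0
    · rw [hk]; exact Tropical.le_zero _
    · obtain ⟨i, j, U, z, hr, rfl, he⟩ := h0.exists_run hk
      rw [he]; exact hle i j U z hr
  · by_cases hk : S k = 0
    · rw [hk]; exact Tropical.le_zero _
    · obtain ⟨i, j, U, z, hr, rfl, he⟩ := hex k hk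
      exact (h0.le_runWeight hr).trans he

/-- All entries of finite weight are bounded by `W` in absolute value. -/
def AbsLe (r : Realization Zmin N) (W : ℕ) : Prop :=
  (∀ i, |(r.c i).toInt| ≤ W) ∧ (∀ i j, |(r.A i j).toInt| ≤ W) ∧ ∀ i, |(r.b i).toInt| ≤ W

theorem AbsLe.edgeWeight {r : Realization Zmin N} {W : ℕ} (h : r.AbsLe W)
    (z : Fin N × Fin N → ℕ) : |r.edgeWeight z| ≤ W * edgeCount z := by
  rw [Realization.edgeWeight]
  refine (Finset.abs_sum_le_sum_abs _ _).trans ?_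
  push_cast
  rw [Finset.mul_sum]
  refine Finset.sum_le_sum fun e _ => ?_
  rw [abs_mul, Nat.abs_cast, mul_comm]
  exact mul_le_mul_of_nonneg_right (h.2.1 _ _) (by positivity)

theorem AbsLe.runWeight {r : Realization Zmin N} {W : ℕ} (h : r.AbsLe W) (i j : Fin N)
    (z : Fin N × Fin N → ℕ) : |r.runWeight i j z| ≤ W * (edgeCount z + 2) := by
  have h1 := h.1 i
  have h2 := h.edgeWeight z
  have h3 := h.2.2 j
  rw [Realization.runWeight]
  rw [abs_le] at *
  constructor <;> linarith

theorem Run.insert_loop {r : Realization Zmin N} {i j : Fin N} {U : Finset (Fin N)}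
    {z σ : Fin N × Fin N → ℕ} (h : r.Run i j U z) (hσ : EdgeWalk.Loop r.Edge U σ) :
    r.Run i j U (z + σ) := ⟨h.1, h.2.1, h.2.2.insert_loop hσ⟩

theorem Run.exists_pump_decomposition {r : Realization Zmin N} {n : ℕ} (hn : N ≤ n) (K : ℕ)
    {i j : Fin N} {U : Finset (Fin N)} {z : Fin N × Fin N → ℕ} (h : r.Run i j U z) :
    ∃ z₀ m, z = z₀ + Multiset.sum m ∧ r.Run i j U z₀ ∧
      edgeCount z₀ ≤ EdgeWalk.pumpLength n + n.factorial + K ∧ (m = 0 ∨ K ≤ edgeCount z₀) ∧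
      ∀ σ ∈ m, EdgeWalk.Loop r.Edge U σ ∧ edgeCount σ = n.factorial := by
  obtain ⟨z₀, m, h1, h2, h3⟩ := h.2.2.exists_pump_decomposition (by simpa using hn) K
  exact ⟨z₀, m, h1, ⟨h.1, h.2.1, h2⟩, h3⟩

/-! ### Ultimate cyclicity and the equality test -/

/-- From this index on, sequences realized in dimension at most `n` with weights bounded by `W` are
geometric along the residue classes modulo `n !`. -/
def cycleStart (n W : ℕ) : ℕ :=
  (EdgeWalk.pumpLength n + n.factorial) + n.factorial * (2 * W * (EdgeWalk.pumpLength n + n.factorial + 2) +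
    (EdgeWalk.pumpLength n + n.factorial) * (W * n.factorial) + 1)

theorem edgeCount_multiset_sum {V : Type*} [Fintype V] (m : Multiset (V × V → ℕ)) (P : ℕ)
    (hm : ∀ σ ∈ m, edgeCount σ = P) : edgeCount m.sum = m.card * P := by
  induction m using Multiset.induction_on with
  | empty => simp [edgeCount]
  | cons c m ih =>
    rw [Multiset.sum_cons, edgeCount_add, ih fun x hx => hm x (Multiset.mem_cons_of_mem hx),
      hm c (Multiset.mem_cons_self _ _), Multiset.card_cons]
    ring

/-- Ultimate cyclicity. -/
theorem Recognizes.exists_cyclic {r : Realization Zmin N} {S : ℕ → Zmin} (h : r.Recognizes S)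
    {n W : ℕ} (hn : N ≤ n) (hW : r.AbsLe W) (ρ : ℕ) :
    ∃ l : ℤ, |l| ≤ W * n.factorial ∧ ∀ k, cycleStart n W ≤ k → k % n.factorial = ρ →
      S (k + n.factorial) = Zmin.ofInt l * S k := by
  classical
  set P := n.factorial with hP
  have hPpos : 0 < P := n.factorial_pos
  set T := EdgeWalk.pumpLength n + P with hT
  -- Weights of loops of length `P` attachable to a short run whose length lies in the class `ρ`.
  -- The least such weight is the factor for this class.
  let Fam : ℤ → Prop := fun l => ∃ i j U z σ, r.Run i j U z ∧ edgeCount z ≤ T ∧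
    edgeCount z % P = ρ ∧ EdgeWalk.Loop r.Edge U σ ∧ edgeCount σ = P ∧ r.edgeWeight σ = l
  have hk0 : cycleStart n W = T + P * (2 * W * (T + 2) + T * (W * P) + 1) := rfl
  have hTk : T < cycleStart n W := by
    rw [hk0]
    exact Nat.lt_add_of_pos_right (Nat.mul_pos hPpos (Nat.succ_pos _))
  have hdec : ∀ {i j U z}, r.Run i j U z → T < edgeCount z → edgeCount z % P = ρ →
      ∃ z₀ m, z = z₀ + Multiset.sum m ∧ r.Run i j U z₀ ∧ edgeCount z₀ ≤ T ∧ m ≠ 0 ∧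
        edgeCount z₀ + m.card * P = edgeCount z ∧
        ∀ σ ∈ m, EdgeWalk.Loop r.Edge U σ ∧ edgeCount σ = P ∧ Fam (r.edgeWeight σ) := by
    intro i j U z hr hz hρ
    obtain ⟨z₀, m, rfl, h1, h2, -, h3⟩ := hr.exists_pump_decomposition hn 0
    have h4 := edgeCount_multiset_sum m P fun σ hσ => (h3 σ hσ).2
    rw [edgeCount_add, h4] at hz hρ
    refine ⟨z₀, m, rfl, h1, h2, ?_, by rw [edgeCount_add, h4], ?_⟩
    · rintro rfl
      simp at hz
      omega
    · intro σ hσ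
      refine ⟨(h3 σ hσ).1, (h3 σ hσ).2, i, j, U, z₀, σ, h1, h2, ?_, (h3 σ hσ).1, (h3 σ hσ).2, rfl⟩
      simpa using hρ
  by_cases hF : ∃ l, Fam l
  · have hlow : ∀ l, Fam l → |l| ≤ W * P := by
      rintro l ⟨i, j, U, z, σ, -, -, -, -, hσ, rfl⟩
      simpa [hσ] using hW.edgeWeight σ
    obtain ⟨l, hl, hmin⟩ := Int.exists_least_of_bdd
      ⟨-(W * P : ℤ), fun l hl => (abs_le.1 (hlow l hl)).1⟩ hF
    refine ⟨l, hlow l hl, ?_⟩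
    have hlabs := hlow l hl
    obtain ⟨is, js, Us, zs, σs, hrs, hzs, hρs, hLs, hσs, hls⟩ := hl
    have claim : ∀ k, cycleStart n W ≤ k → k % P = ρ → ∃ i j U z σ, r.Run i j U z ∧
        EdgeWalk.Loop r.Edge U σ ∧ edgeCount σ = P ∧ r.edgeWeight σ = l ∧
        edgeCount z + P = k ∧ S k = Zmin.ofInt (r.runWeight i j z + l) := by
      intro k hk hkρ
      rw [hk0] at hk
      obtain ⟨q, hq⟩ : ∃ q, k = edgeCount zs + q * P := by
        have hmod : edgeCount zs ≡ k [MOD P] := hρs.trans hkρ.symm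
        obtain ⟨q, hq⟩ := (Nat.modEq_iff_dvd' (by omega)).1 hmod
        exact ⟨q, by rw [mul_comm, ← hq]; omega⟩
      -- A competitor of length `k`: the short run carrying the cheapest loop, with this loop
      -- repeated `q` times.
      have hrun : r.Run is js Us (zs + q • σs) :=
        ⟨hrs.1, hrs.2.1, hrs.2.2.insert_loop (hLs.nsmul q)⟩
      have hle := h.le_runWeight hrun
      rw [edgeCount_add, edgeCount_nsmul, hσs, ← hq, runWeight_add, edgeWeight_nsmul, hls] at hle
      obtain ⟨i, j, U, z, hr, rfl, he⟩ := h.exists_run (Zmin.ne_zero_of_le_ofInt hle)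
      obtain ⟨z₀, m, rfl, hr0, hz0, hm0, hcount, hm⟩ := hdec hr (by omega) hkρ
      rw [he, Zmin.ofInt_le_ofInt, runWeight_add, edgeWeight_sum] at hle
      -- If all loops of the optimal run cost at least `l + 1`, comparison with the competitor
      -- bounds their number by `2 * W * (T + 2) + T * (W * P)`. The first term comes from the two
      -- short runs, the second from `(q - m.card) * l`. The choice of `cycleStart` forces more
      -- loops than that.
      have hex : ∃ σ ∈ m, r.edgeWeight σ = l := by
        by_contra! hcon
        have h1 : (m.card : ℤ) * (l + 1) ≤ (m.map r.edgeWeight).sum := by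
          have := Multiset.card_nsmul_le_sum (s := m.map r.edgeWeight) (a := l + 1) (by
            intro x hx
            obtain ⟨σ, hσ, rfl⟩ := Multiset.mem_map.1 hx
            have h2 := hmin _ (hm σ hσ).2.2
            have h3 := hcon σ hσ
            omega)
          simpa using this
        have h2 := hW.runWeight i j z₀
        have h3 := hW.runWeight is js zs
        have h4 : (W : ℤ) * (edgeCount z₀ + 2) ≤ W * (T + 2) := by gcongr
        have h5 : (W : ℤ) * (edgeCount zs + 2) ≤ W * (T + 2) := by gcongr
        have h6 : 2 * W * (T + 2) + T * (W * P) + 1 ≤ m.card := by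
          by_contra! hlt
          have : m.card * P ≤ P * (2 * W * (T + 2) + T * (W * P)) := by
            rw [mul_comm]; exact Nat.mul_le_mul_left _ (by omega)
          rw [mul_add P] at hk
          omega
        have h7 : |(q : ℤ) - m.card| ≤ T := by
          have e1 : edgeCount z₀ + m.card * P = edgeCount zs + q * P := by omega
          rw [abs_le]
          constructor
          · by_contra! hlt
            have : q + T + 1 ≤ m.card := by omega
            have := Nat.mul_le_mul_right P this
            have h8 : T * 1 ≤ T * P := Nat.mul_le_mul_left T hPpos
            rw [add_mul, add_mul] at this
            omega
          · by_contra! hlt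
            have : m.card + T + 1 ≤ q := by omega
            have := Nat.mul_le_mul_right P this
            have h8 : T * 1 ≤ T * P := Nat.mul_le_mul_left T hPpos
            rw [add_mul, add_mul] at this
            omega
        have h8 : ((q : ℤ) - m.card) * l ≤ T * (W * P) := by
          refine (le_abs_self _).trans ?_
          rw [abs_mul]
          exact mul_le_mul h7 hlabs (abs_nonneg _) (by positivity)
        have h6' : (2 * W * (T + 2) + T * (W * P) + 1 : ℤ) ≤ m.card := by exact_mod_cast h6
        rw [abs_le] at h2 h3
        nlinarith
      obtain ⟨σ, hσm, hσl⟩ := hex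
      obtain ⟨m', rfl⟩ := Multiset.exists_cons_of_mem hσm
      refine ⟨i, j, U, z₀ + m'.sum, σ, ⟨hr0.1, hr0.2.1, hr0.2.2.insert_loops m' fun x hx =>
        (hm x (Multiset.mem_cons_of_mem hx)).1⟩, (hm σ hσm).1, (hm σ hσm).2.1, hσl, ?_, ?_⟩
      · rw [Multiset.sum_cons, edgeCount_add, edgeCount_add, edgeCount_add, (hm σ hσm).2.1]
        omega
      · rw [he, runWeight_add, runWeight_add, Multiset.sum_cons, edgeWeight_add, hσl]
        congr 1; ring
    -- Repeating the cheapest loop in an optimal run of length `k` gives `S (k + P) ≤ S k + l`;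
    -- deleting it from an optimal run of length `k + P` gives the converse.
    intro k hk hkρ
    obtain ⟨i, j, U, z, σ, hr, hL, hσ, hσl, hz, hS⟩ := claim k hk hkρ
    obtain ⟨i', j', U', z', σ', hr', hL', hσ', hσl', hz', hS'⟩ :=
      claim (k + P) (by omega) (by simpa using hkρ)
    have h1 := h.le_runWeight ((hr.insert_loop hL).insert_loop hL)
    have h2 := h.le_runWeight hr'
    rw [edgeCount_add, edgeCount_add, hσ, hz, hS', runWeight_add, runWeight_add, hσl,
      Zmin.ofInt_le_ofInt] at h1
    rw [show edgeCount z' = k by omega, hS, Zmin.ofInt_le_ofInt] at h2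
    rw [hS, hS', ← Zmin.ofInt_add]
    congr 1; omega
  -- Without any such loop there are no long runs in this class, so the terms are infinite and any
  -- factor works.
  · refine ⟨0, by simp; positivity, ?_⟩
    have hzero : ∀ k, cycleStart n W ≤ k → k % P = ρ → S k = 0 := by
      intro k hk hkρ
      by_contra hne
      obtain ⟨i, j, U, z, hr, rfl, -⟩ := h.exists_run hne
      obtain ⟨z₀, m, -, -, -, hm0, -, hm⟩ := hdec hr (by omega) hkρ
      obtain ⟨σ, hσ⟩ := Multiset.exists_mem_of_ne_zero hm0
      exact hF ⟨_, (hm σ hσ).2.2⟩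
    intro k hk hkρ
    rw [hzero k hk hkρ, hzero (k + P) (by omega) (by simpa using hkρ), mul_zero]

/-- Sequences realized in dimension at most `n` with weights bounded by `W` are determined by this
number of initial terms. -/
def equalityBound (n W : ℕ) : ℕ := cycleStart n W + 2 * n.factorial

/-- In the cyclic regime two terms at distance `n !` determine the factor of their class when they
are finite. Hence two periods beyond `cycleStart` suffice; when the terms are infinite the factor is
irrelevant. -/
theorem Recognizes.eq_of_forall_lt {N' : ℕ} {r : Realization Zmin N} {r' : Realization Zmin N'}
    {S S' : ℕ → Zmin} (h : r.Recognizes S) (h' : r'.Recognizes S') {n W : ℕ} (hn : N ≤ n)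
    (hn' : N' ≤ n) (hW : r.AbsLe W) (hW' : r'.AbsLe W)
    (heq : ∀ k < equalityBound n W, S k = S' k) : S = S' := by
  have hpos := n.factorial_pos
  funext k
  induction k using Nat.strong_induction_on with
  | _ k ih =>
    by_cases hk : k < equalityBound n W
    · exact heq k hk
    rw [equalityBound] at hk
    obtain ⟨l, -, hl⟩ := h.exists_cyclic hn hW (k % n.factorial)
    obtain ⟨l', -, hl'⟩ := h'.exists_cyclic hn' hW' (k % n.factorial)
    obtain ⟨k, rfl⟩ : ∃ k₀, k = k₀ + n.factorial + n.factorial :=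
      ⟨k - n.factorial - n.factorial, by omega⟩
    simp only [Nat.add_mod_right] at hl hl'
    have e1 := ih k (by omega)
    have e2 := ih (k + n.factorial) (by omega)
    rw [hl (k + n.factorial) (by omega) (by simp), hl' (k + n.factorial) (by omega) (by simp), ← e2]
    rw [hl k (by omega) rfl, hl' k (by omega) rfl, ← e1] at e2
    rw [hl k (by omega) rfl]
    by_cases h0 : S k = 0
    · simp [h0]
    · obtain ⟨m, hm⟩ := Zmin.exists_eq_ofInt h0
      rw [hm, ← Zmin.ofInt_add, ← Zmin.ofInt_add] at e2
      have := Zmin.ofInt_injective e2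
      rw [show l = l' by omega]

end Realization

/-! ### Realizations with bounded weights -/

/-- Since `H ≥ 1`, the forms `± x d` are among the preserved inequalities, which keeps signs and
zeros. -/
theorem exists_small_solution_nonneg {ι : Type*} [Fintype ι] (x : ι → ℤ) (H : ℕ) (hH : 0 < H)
    (t : ι) (ht : 0 < x t) :
    ∃ y : ι → ℤ,
      (∀ φ : ι → ℤ, (∀ d, |φ d| ≤ H) → ∑ d, φ d * x d ≤ 0 → ∑ d, φ d * y d ≤ 0) ∧
      0 < y t ∧ y t ≤ x t ∧
      (∀ d, |y d| ≤ blockBound (H + 1) ((2 * H + 1) ^ Fintype.card ι)) ∧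
      (∀ d, 0 ≤ x d → 0 ≤ y d) ∧ ∀ d, x d = 0 → y d = 0 := by
  classical
  obtain ⟨y, h1, h2, h3, h4⟩ := exists_small_solution x H t ht
  have hnn : ∀ d, 0 ≤ x d → 0 ≤ y d := by
    intro d hd
    have := h1 (fun e => if e = d then -1 else 0)
      (fun e => by split_ifs <;> simp [Nat.one_le_iff_ne_zero, hH.ne']) (by simpa using hd)
    simpa using this
  refine ⟨y, h1, h2, h3, h4, hnn, fun d hd => le_antisymm ?_ (hnn d hd.ge)⟩
  have := h1 (fun e => if e = d then 1 else 0)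
    (fun e => by split_ifs <;> simp [Nat.one_le_iff_ne_zero, hH.ne']) (by simp [hd])
  simpa using this

namespace Realization

variable {N : ℕ}

/-- The positions of the entries of a triple of dimension `N`. -/
abbrev Position (N : ℕ) : Type := Fin N ⊕ (Fin N × Fin N) ⊕ Fin N

/-- The integer weights of a triple. -/
def weights (r : Realization Zmin N) : Position N → ℤ
  | .inl i => (r.c i).toInt
  | .inr (.inl e) => (r.A e.1 e.2).toInt
  | .inr (.inr i) => (r.b i).toInt

/-- The triple with the same support as `r` and weights `y`. -/
def reweight (r : Realization Zmin N) (y : Position N → ℤ) : Realization Zmin N where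
  c i := if r.c i = 0 then 0 else Zmin.ofInt (y (.inl i))
  A := .of fun i j => if r.A i j = 0 then 0 else Zmin.ofInt (y (.inr (.inl (i, j))))
  b i := if r.b i = 0 then 0 else Zmin.ofInt (y (.inr (.inr i)))

/-- Infinite entries have weight `0` by convention and stay infinite, so `y` has to vanish there. -/
theorem weights_reweight (r : Realization Zmin N) (y : Position N → ℤ)
    (hy : ∀ d, r.weights d = 0 → y d = 0) (d : Position N) : (r.reweight y).weights d = y d := by
  have key : ∀ (x : Zmin) (d : Position N), r.weights d = x.toInt →
      Zmin.toInt (if x = 0 then 0 else Zmin.ofInt (y d)) = y d := by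
    intro x d hx
    split_ifs with h
    · rw [hy d (by rw [hx, h, Zmin.toInt_zero]), Zmin.toInt_zero]
    · exact Zmin.toInt_ofInt _
  rcases d with i | e | i
  · exact key _ _ rfl
  · exact key _ _ rfl
  · exact key _ _ rfl

theorem run_reweight (r : Realization Zmin N) (y : Position N → ℤ) (i j : Fin N)
    (U : Finset (Fin N)) (z : Fin N × Fin N → ℕ) : (r.reweight y).Run i j U z ↔ r.Run i j U z := by
  have h1 : ∀ (x : Zmin) (m : ℤ), (if x = 0 then 0 else Zmin.ofInt m) ≠ 0 ↔ x ≠ 0 := by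
    intro x m
    split_ifs with h
    · simp [h]
    · simp [h, Zmin.ofInt_ne_zero]
  have h2 : (r.reweight y).Edge = r.Edge := by
    funext i j
    exact propext (h1 _ _)
  rw [Run, Run, h2]
  exact and_congr (h1 _ _) (and_congr (h1 _ _) Iff.rfl)

/-- The weight of a run as a linear form in the weights of the entries. -/
def runForm (i j : Fin N) (z : Fin N × Fin N → ℕ) : Position N → ℤ
  | .inl i' => if i' = i then 1 else 0
  | .inr (.inl e) => z e
  | .inr (.inr j') => if j' = j then 1 else 0

/-- The weight of an edge multiset as a linear form in the weights of the entries. -/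
def edgeForm (z : Fin N × Fin N → ℕ) : Position N → ℤ
  | .inl _ => 0
  | .inr (.inl e) => z e
  | .inr (.inr _) => 0

theorem runWeight_eq_sum (r : Realization Zmin N) (i j : Fin N) (z : Fin N × Fin N → ℕ) :
    r.runWeight i j z = ∑ d, runForm i j z d * r.weights d := by
  simp [Fintype.sum_sum_type, runForm, weights, runWeight, edgeWeight, add_assoc]

theorem edgeWeight_eq_sum (r : Realization Zmin N) (z : Fin N × Fin N → ℕ) :
    r.edgeWeight z = ∑ d, edgeForm z d * r.weights d := by
  simp [Fintype.sum_sum_type, edgeForm, weights, edgeWeight]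

theorem le_edgeCount (z : Fin N × Fin N → ℕ) (e : Fin N × Fin N) : z e ≤ edgeCount z :=
  Finset.single_le_sum (by simp) (Finset.mem_univ e)

/-- All weights are nonnegative. -/
def Nonneg (r : Realization Zmin N) : Prop := ∀ d, 0 ≤ r.weights d

theorem absLe_iff (r : Realization Zmin N) (W : ℕ) : r.AbsLe W ↔ ∀ d, |r.weights d| ≤ W := by
  constructor
  · rintro ⟨h1, h2, h3⟩ (i | e | i)
    exacts [h1 i, h2 _ _, h3 i]
  · intro h
    exact ⟨fun i => h (.inl i), fun i j => h (.inr (.inl (i, j))), fun i => h (.inr (.inr i))⟩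

/-- The bound on the lengths of the runs which matter for the realization problem. -/
def runBound (n W : ℕ) : ℕ := EdgeWalk.pumpLength n + n.factorial + cycleStart n W

/-- The bound on the coefficients of the inequalities describing the realizations. -/
def coeffBound (n W : ℕ) : ℕ := (W + 1) * (runBound n W + 2)

/-- The bound on the weights of a small realization. -/
def weightBound (n W : ℕ) : ℕ :=
  blockBound (coeffBound n W + 1) ((2 * coeffBound n W + 1) ^ (n * n + 2 * n + 1))

theorem Recognizes.cyclic_iterate {S : ℕ → Zmin} {P K : ℕ} {s l : ℤ} {k₀ : ℕ} (hk : K ≤ k₀)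
    (hl : ∀ k, K ≤ k → k % P = k₀ % P → S (k + P) = Zmin.ofInt l * S k)
    (hs : S k₀ = Zmin.ofInt s) (q : ℕ) : S (k₀ + q * P) = Zmin.ofInt (s + q * l) := by
  induction q with
  | zero => simpa using hs
  | succ q ih =>
    rw [add_mul, one_mul, ← add_assoc, hl _ (by nlinarith [Nat.zero_le (q * P)]) (by simp), ih,
      ← Zmin.ofInt_add]
    congr 1; push_cast; ring

/-- If `S ^ t` is realized with dimension `N` then some `S ^ t'`, `0 < t' ≤ t`, is realized with
dimension `N` and bounded weights. -/
theorem Recognizes.exists_small {M : ℕ} {r : Realization Zmin M} {r' : Realization Zmin N}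
    {S : ℕ → Zmin} {t : ℕ} (h : r.Recognizes S) (ht : 0 < t) (h' : r'.Recognizes fun k => S k ^ t)
    {n W : ℕ} (hn : M ≤ n) (hn' : N ≤ n) (hW : r.AbsLe W) :
    ∃ (t' : ℕ) (r'' : Realization Zmin N), 0 < t' ∧ t' ≤ t ∧ t' ≤ weightBound n W ∧
      r''.AbsLe (weightBound n W) ∧ (r''.Recognizes fun k => S k ^ t') ∧
      (r'.Nonneg → r''.Nonneg) := by
  classical
  set P := n.factorial with hP
  set H := coeffBound n W with hH
  have hHdef : H = (W + 1) * (runBound n W + 2) := rfl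
  have hPT : P ≤ runBound n W := by rw [runBound]; omega
  have hTH : runBound n W + 2 ≤ H := by rw [hHdef]; exact Nat.le_mul_of_pos_left _ (by omega)
  have hWH : W * (runBound n W + 2) ≤ H := by rw [hHdef]; exact Nat.mul_le_mul_right _ (by omega)
  -- The exponent `t` is an unknown of its own, at `none`. This makes the bounds `t * s ≤ weight`
  -- homogeneous, with `s` as a coefficient.
  let x : Option (Position N) → ℤ := fun d => d.elim t r'.weights
  obtain ⟨y, hy, hy0, hyt, hyb, hynn, hyz⟩ :=
    exists_small_solution_nonneg x H (by omega) none (by simpa [x] using ht)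
  have hyb' : ∀ d, |y d| ≤ weightBound n W := by
    intro d
    refine (hyb d).trans ?_
    rw [weightBound]
    norm_cast
    refine blockBound_mono _ (Nat.pow_le_pow_right (by omega) ?_)
    simp only [Fintype.card_option, Fintype.card_sum, Fintype.card_prod, Fintype.card_fin]
    have := Nat.mul_le_mul hn' hn'
    omega
  obtain ⟨t', ht'⟩ := Int.eq_ofNat_of_zero_le hy0.le
  let r'' := r'.reweight fun d => y (some d)
  have hw : ∀ d, r''.weights d = y (some d) :=
    weights_reweight _ _ fun d hd => hyz (some d) hd
  -- Both directions are inherited by the new weights, so lower bounds are kept and tight ones stay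
  -- tight.
  have form : ∀ (s : ℤ) (φ : Position N → ℤ), |s| ≤ H → (∀ d, |φ d| ≤ H) →
      (t * s ≤ ∑ d, φ d * r'.weights d → t' * s ≤ ∑ d, φ d * r''.weights d) ∧
      (∑ d, φ d * r'.weights d ≤ t * s → ∑ d, φ d * r''.weights d ≤ t' * s) := by
    intro s φ hs hφ
    have h1 := hy (fun d => d.elim s fun d => -φ d) (by rintro (_ | d) <;> simp [hs, hφ])
    have h2 := hy (fun d => d.elim (-s) φ) (by rintro (_ | d) <;> simp [hs, hφ])
    simp only [Fintype.sum_option, Option.elim, x, ht', neg_mul, Finset.sum_neg_distrib] at h1 h2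
    simp only [hw]
    refine ⟨fun h3 => ?_, fun h3 => ?_⟩
    · have := h1 (by linarith)
      linarith
    · have := h2 (by linarith)
      linarith
  have key : ∀ i j U z, r'.Run i j U z → ∃ s : ℤ, S (edgeCount z) = Zmin.ofInt s ∧
      t' * s ≤ r''.runWeight i j z ∧
      (r'.runWeight i j z ≤ t * s → r''.runWeight i j z ≤ t' * s) := by
    intro i j U z hr
    have hlow : ∀ {z}, r'.Run i j U z → ∃ s : ℤ, S (edgeCount z) = Zmin.ofInt s ∧
        t * s ≤ r'.runWeight i j z := by
      intro z hr
      have h1 := h'.le_runWeight hr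
      have h2 : S (edgeCount z) ≠ 0 := by
        intro h0
        have := Zmin.ne_zero_of_le_ofInt h1
        simp only [h0] at this
        exact this (zero_pow ht.ne')
      obtain ⟨s, hs⟩ := Zmin.exists_eq_ofInt h2
      refine ⟨s, hs, ?_⟩
      simpa only [hs, Zmin.ofInt_pow, Zmin.ofInt_le_ofInt] using h1
    obtain ⟨z₀, m, rfl, hr0, hz0, hK, hm⟩ := hr.exists_pump_decomposition hn' (cycleStart n W)
    have hz0' : edgeCount z₀ ≤ runBound n W := hz0
    obtain ⟨s, hs, hs0⟩ := hlow hr0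
    -- The coefficient `s` is small because it is the weight of a run of the given realization `r`,
    -- of the same bounded length.
    have hsabs : |s| ≤ H := by
      obtain ⟨i₁, j₁, U₁, z₁, -, hz₁, he⟩ := h.exists_run (k := edgeCount z₀)
        (by rw [hs]; exact Zmin.ofInt_ne_zero s)
      rw [hs] at he
      rw [Zmin.ofInt_injective he]
      refine (hW.runWeight i₁ j₁ z₁).trans ?_
      rw [hz₁]
      calc (W : ℤ) * (edgeCount z₀ + 2) ≤ W * (runBound n W + 2) := by gcongr
        _ ≤ H := by exact_mod_cast hWH
    have hform0 := form s (runForm i j z₀) hsabs (by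
      have := le_edgeCount z₀
      rintro (i' | e | j')
      · simp only [runForm]; split_ifs <;> simp; omega
      · simp only [runForm, Nat.abs_cast]
        exact_mod_cast ((this e).trans hz0').trans (by omega)
      · simp only [runForm]; split_ifs <;> simp; omega)
    rw [← runWeight_eq_sum, ← runWeight_eq_sum] at hform0
    obtain ⟨l, hlabs, hl⟩ := h.exists_cyclic hn hW (edgeCount z₀ % P)
    have hloop : ∀ σ ∈ m, t * l ≤ r'.edgeWeight σ ∧ t' * l ≤ r''.edgeWeight σ ∧
        (r'.edgeWeight σ ≤ t * l → r''.edgeWeight σ ≤ t' * l) := by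
      intro σ hσ
      obtain ⟨hL, hσP⟩ := hm σ hσ
      have hK' : cycleStart n W ≤ edgeCount z₀ := by
        rcases hK with rfl | hK
        · simp at hσ
        · exact hK
      -- A loop cheaper than `t * l` would lose at least `1` at each insertion. After `q`
      -- insertions, more than the excess weight of the short run, it would undercut `S ^ t`.
      have h1 : t * l ≤ r'.edgeWeight σ := by
        by_contra! hlt
        let q : ℕ := (r'.runWeight i j z₀ - t * s).toNat + 1
        obtain ⟨s₁, hs₁, hq⟩ := hlow (z := z₀ + q • σ)
          ⟨hr0.1, hr0.2.1, hr0.2.2.insert_loop (hL.nsmul q)⟩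
        rw [edgeCount_add, edgeCount_nsmul, hσP, Recognizes.cyclic_iterate hK' hl hs] at hs₁
        rw [← Zmin.ofInt_injective hs₁, runWeight_add, edgeWeight_nsmul] at hq
        have hq1 : r'.runWeight i j z₀ - t * s < q := by
          have := Int.self_le_toNat (r'.runWeight i j z₀ - t * s)
          push_cast [q]; omega
        have : (q : ℤ) * (r'.edgeWeight σ + 1) ≤ q * (t * l) := by
          apply mul_le_mul_of_nonneg_left _ (by positivity)
          omega
        nlinarith
      have hform := form l (edgeForm σ) (hlabs.trans (by
          calc (W : ℤ) * P ≤ W * (runBound n W + 2) := by gcongr; exact_mod_cast hPT.trans (by omega)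
            _ ≤ H := by exact_mod_cast hWH)) (by
        have := le_edgeCount σ
        rintro (i' | e | j')
        · simp [edgeForm]
        · simp only [edgeForm, Nat.abs_cast]
          exact_mod_cast ((this e).trans hσP.le).trans (by omega)
        · simp [edgeForm])
      rw [← edgeWeight_eq_sum, ← edgeWeight_eq_sum] at hform
      exact ⟨h1, hform.1 h1, hform.2⟩
    -- Each loop satisfies its lower bound, so equality for the sum forces equality for every loop.
    have hsum : t * (m.card * l) ≤ r'.edgeWeight m.sum ∧ t' * (m.card * l) ≤ r''.edgeWeight m.sum ∧
        (r'.edgeWeight m.sum ≤ t * (m.card * l) → r''.edgeWeight m.sum ≤ t' * (m.card * l)) := by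
      clear hr hK hm
      induction m using Multiset.induction_on with
      | empty => simp [edgeWeight]
      | cons σ m ih =>
        obtain ⟨h1, h2, h3⟩ := ih fun τ hτ => hloop τ (Multiset.mem_cons_of_mem hτ)
        obtain ⟨h4, h5, h6⟩ := hloop σ (Multiset.mem_cons_self _ _)
        simp only [Multiset.sum_cons, edgeWeight_add, Multiset.card_cons]
        push_cast
        refine ⟨by linarith, by linarith, fun h7 => ?_⟩
        have := h3 (by linarith)
        have := h6 (by linarith)
        linarith
    refine ⟨s + m.card * l, ?_, ?_, ?_⟩
    · rw [edgeCount_add, edgeCount_multiset_sum m P fun σ hσ => (hm σ hσ).2]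
      rcases hK with rfl | hK
      · simpa using hs
      · exact Recognizes.cyclic_iterate hK hl hs _
    · rw [runWeight_add]
      have := hform0.1 hs0
      linarith [hsum.2.1]
    · intro h1
      rw [runWeight_add] at h1 ⊢
      have h2 := hform0.2 (by linarith [hsum.1])
      have h3 := hsum.2.2 (by linarith)
      linarith
  refine ⟨t', r'', by omega, by simp only [x, Option.elim] at hyt; omega, ?_, ?_, ?_, ?_⟩
  · have := hyb' none
    rw [ht', Nat.abs_cast] at this
    exact_mod_cast this
  · rw [absLe_iff]
    intro d
    rw [hw]; exact hyb' _
  -- The supports agree, hence so do the runs: all obey the lower bound, and a run optimal for `r'`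
  -- remains optimal.
  · apply recognizes_of_run
    · intro i j U z hr
      obtain ⟨s, hs, h1, -⟩ := key i j U z ((run_reweight _ _ _ _ _ _).1 hr)
      simp only [hs, Zmin.ofInt_pow]
      exact Zmin.ofInt_le_ofInt.2 h1
    · intro k hk
      have hSk : S k ≠ 0 := by
        intro h0
        exact hk (by simp only [h0]; exact zero_pow (by omega))
      obtain ⟨s, hs⟩ := Zmin.exists_eq_ofInt hSk
      obtain ⟨i, j, U, z, hr, rfl, he⟩ := h'.exists_run (k := k) (by
        simp only [hs, Zmin.ofInt_pow]; exact Zmin.ofInt_ne_zero _)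
      obtain ⟨s', hs', -, h2⟩ := key i j U z hr
      rw [hs] at hs'
      cases Zmin.ofInt_injective hs'
      simp only [hs, Zmin.ofInt_pow] at he
      refine ⟨i, j, U, z, (run_reweight _ _ _ _ _ _).2 hr, rfl, ?_⟩
      simp only [hs, Zmin.ofInt_pow]
      exact Zmin.ofInt_le_ofInt.2 (h2 (Zmin.ofInt_injective he).ge)
  · intro hnn d
    rw [hw]
    exact hynn (some d) (hnn d)

end Realization

/-! ### Transfer of realizations along homomorphisms -/

/-- The homomorphism of tropical semirings induced by a monotone homomorphism of additive
monoids. -/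
def Tropical.mapWithTop {Γ Δ : Type} [AddCancelCommMonoid Γ] [LinearOrder Γ] [IsOrderedAddMonoid Γ]
    [AddCancelCommMonoid Δ] [LinearOrder Δ] [IsOrderedAddMonoid Δ]
    (f : Γ →+ Δ) (hf : Monotone f) :
    Tropical (WithTop Γ) →+* Tropical (WithTop Δ) where
  toFun x := Tropical.trop ((Tropical.untrop x).map f)
  map_zero' := rfl
  map_one' := congrArg (fun d : Δ => Tropical.trop (d : WithTop Δ)) f.map_zero
  map_add' _ _ := congrArg Tropical.trop (hf.withTop_map.map_min)
  map_mul' _ _ := congrArg Tropical.trop (WithTop.map_add f _ _)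

theorem Tropical.mapWithTop_injective {Γ Δ : Type} [AddCancelCommMonoid Γ] [LinearOrder Γ]
    [IsOrderedAddMonoid Γ] [AddCancelCommMonoid Δ] [LinearOrder Δ] [IsOrderedAddMonoid Δ]
    (f : Γ →+ Δ) (hf : Monotone f) (hinj : Function.Injective f) :
    Function.Injective (Tropical.mapWithTop f hf) := fun x y h => by
  have h' : (Tropical.untrop x).map f = (Tropical.untrop y).map f := congrArg Tropical.untrop h
  exact Tropical.untrop_injective (Option.map_injective hinj h')

namespace Realization

variable {K L : Type} {N : ℕ}

/-- Every entry of the triple satisfies `p`. -/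
def Entries (r : Realization K N) (p : K → Prop) : Prop :=
  (∀ i, p (r.c i)) ∧ (∀ i j, p (r.A i j)) ∧ ∀ i, p (r.b i)

theorem Entries.mono {r : Realization K N} {p q : K → Prop} (h : r.Entries p)
    (hpq : ∀ x, p x → q x) : r.Entries q :=
  ⟨fun i => hpq _ (h.1 i), fun i j => hpq _ (h.2.1 i j), fun i => hpq _ (h.2.2 i)⟩

/-- Entrywise transfer of a triple along a relation. -/
theorem Entries.exists_transfer {r : Realization K N} {R : K → L → Prop}
    (h : r.Entries fun x => ∃ y, R x y) : ∃ r' : Realization L N, (∀ i, R (r.c i) (r'.c i)) ∧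
      (∀ i j, R (r.A i j) (r'.A i j)) ∧ ∀ i, R (r.b i) (r'.b i) := by
  choose c hc using h.1
  choose A hA using h.2.1
  choose b hb using h.2.2
  exact ⟨⟨c, .of A, b⟩, hc, hA, hb⟩

theorem exists_entries_le (r : Realization K N) (f : K → ℕ) : ∃ W, r.Entries fun x => f x ≤ W := by
  classical
  obtain ⟨W₁, h₁⟩ := (Set.finite_range fun i => f (r.c i)).bddAbove
  obtain ⟨W₂, h₂⟩ := (Set.finite_range fun e : Fin N × Fin N => f (r.A e.1 e.2)).bddAbove
  obtain ⟨W₃, h₃⟩ := (Set.finite_range fun i => f (r.b i)).bddAbove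
  exact ⟨W₁ + W₂ + W₃, fun i => (h₁ ⟨i, rfl⟩).trans (by omega),
    fun i j => (h₂ ⟨(i, j), rfl⟩).trans (by omega), fun i => (h₃ ⟨i, rfl⟩).trans (by omega)⟩

variable [CommSemiring K] [CommSemiring L]

/-- The image of a triple under a homomorphism. -/
def map (r : Realization K N) (φ : K →+* L) : Realization L N where
  c i := φ (r.c i)
  A := r.A.map φ
  b i := φ (r.b i)

theorem map_eval (r : Realization K N) (φ : K →+* L) (k : ℕ) :
    (r.map φ).c ⬝ᵥ ((r.map φ).A ^ k *ᵥ (r.map φ).b) = φ (r.c ⬝ᵥ (r.A ^ k *ᵥ r.b)) := by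
  have h1 : (r.map φ).A ^ k = (r.A ^ k).map φ := (map_pow φ.mapMatrix r.A k).symm
  rw [h1]
  simp [dotProduct, Matrix.mulVec, map, map_sum]

theorem Recognizes.map {r : Realization K N} {S : ℕ → K} (h : r.Recognizes S) (φ : K →+* L) :
    (r.map φ).Recognizes fun k => φ (S k) := fun k => by
  rw [map_eval]
  exact congrArg φ (h k)

theorem Recognizes.of_map {r : Realization K N} {S : ℕ → K} {φ : K →+* L}
    (hφ : Function.Injective φ) (h : (r.map φ).Recognizes fun k => φ (S k)) : r.Recognizes S :=
  fun k => hφ ((h k).trans (r.map_eval φ k))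

end Realization

/-! ### Rational weights and clearing denominators -/

/-- The min-plus semiring of rationals. -/
abbrev Qmin : Type := Tropical (WithTop ℚ)

namespace Qmin

/-- The finite element of `Qmin` given by a rational. -/
def ofRat (q : ℚ) : Qmin := Tropical.trop (q : WithTop ℚ)

/-- The rational given by a finite element of `Qmin`, and `0` for `∞`. -/
def toRat (x : Qmin) : ℚ := (Tropical.untrop x).untopD 0

/-- The size of the finite representation of an element. -/
def height (x : Qmin) : ℕ := (toRat x).num.natAbs + (toRat x).den

theorem eq_zero_or_ofRat (x : Qmin) : x = 0 ∨ ∃ q, x = ofRat q := by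
  induction x using Tropical.tropRec with
  | h x =>
    induction x using WithTop.recTopCoe with
    | top => exact Or.inl rfl
    | coe q => exact Or.inr ⟨q, rfl⟩

theorem ofRat_pow (q : ℚ) (t : ℕ) : ofRat q ^ t = ofRat (t * q) := by
  induction t with
  | zero => simp; rfl
  | succ t ih =>
    rw [pow_succ, ih, show ofRat (t * q) * ofRat q = ofRat (t * q + q) from rfl]
    congr 1; push_cast; ring

/-- Multiplication by a nonnegative rational, as an endomorphism of `Qmin`. -/
def scale (a : ℚ) (ha : 0 ≤ a) : Qmin →+* Qmin :=
  Tropical.mapWithTop (AddMonoidHom.mulLeft a) fun _ _ h => mul_le_mul_of_nonneg_left h ha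

theorem scale_ofRat (a : ℚ) (ha : 0 ≤ a) (q : ℚ) : scale a ha (ofRat q) = ofRat (a * q) := rfl

theorem scale_injective (a : ℚ) (ha : 0 < a) : Function.Injective (scale a ha.le) :=
  Tropical.mapWithTop_injective _ _ fun _ _ h => mul_left_cancel₀ ha.ne' h

theorem scale_natCast (t : ℕ) (ht : 0 < t) (x : Qmin) : scale t (Nat.cast_nonneg t) x = x ^ t := by
  rcases eq_zero_or_ofRat x with rfl | ⟨q, rfl⟩
  · rw [map_zero, zero_pow ht.ne']
  · rw [scale_ofRat, ofRat_pow]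

end Qmin

namespace Zmin

/-- The inclusion of `Zmin` into `Qmin`. -/
def toQmin : Zmin →+* Qmin := Tropical.mapWithTop (Int.castAddHom ℚ) Int.cast_mono

theorem toQmin_injective : Function.Injective toQmin :=
  Tropical.mapWithTop_injective _ _ Int.cast_injective

theorem toQmin_ofInt (m : ℤ) : toQmin (ofInt m) = Qmin.ofRat m := rfl

theorem toRat_toQmin (x : Zmin) : Qmin.toRat (toQmin x) = toInt x := by
  by_cases h : x = 0
  · subst h; simp [toInt_zero]; rfl
  · obtain ⟨m, rfl⟩ := exists_eq_ofInt h; rfl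

theorem height_toQmin (x : Zmin) : Qmin.height (toQmin x) = (toInt x).natAbs + 1 := by
  rw [Qmin.height, toRat_toQmin, Rat.num_intCast, Rat.den_intCast]

end Zmin

theorem Qmin.exists_scale_eq_toQmin (x : Qmin) (D : ℕ) (hD : (toRat x).den ∣ D) :
    ∃ y : Zmin, Zmin.toQmin y = scale D (Nat.cast_nonneg D) x ∧
      |y.toInt| ≤ (height x * D : ℕ) := by
  rcases eq_zero_or_ofRat x with rfl | ⟨q, rfl⟩
  · exact ⟨0, by simp, by simp only [Zmin.toInt_zero, abs_zero]; positivity⟩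
  · change q.den ∣ D at hD
    obtain ⟨d, rfl⟩ := hD
    refine ⟨Zmin.ofInt (d * q.num), ?_, ?_⟩
    · rw [Zmin.toQmin_ofInt, scale_ofRat]
      congr 1
      push_cast
      rw [mul_comm (q.den : ℚ), mul_assoc, Rat.den_mul_eq_num]
    · rw [Zmin.toInt_ofInt, abs_mul, Nat.abs_cast, Int.abs_eq_natAbs]
      change _ ≤ (((q.num.natAbs + q.den) * (q.den * d) : ℕ) : ℤ)
      have := q.den_pos
      norm_cast
      calc d * q.num.natAbs ≤ (q.den * d) * (q.num.natAbs + q.den) :=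
            Nat.mul_le_mul (Nat.le_mul_of_pos_left _ this) (by omega)
        _ = _ := mul_comm _ _

namespace Realization

variable {N : ℕ}

/-- Clearing denominators. -/
theorem exists_map_scale_eq {r : Realization Qmin N} {W : ℕ}
    (h : r.Entries fun x => x.height ≤ W) (D : ℕ) (hD : W.factorial ∣ D) :
    ∃ r' : Realization Zmin N, r'.map Zmin.toQmin = r.map (Qmin.scale D (Nat.cast_nonneg D)) ∧
      r'.AbsLe (W * D) := by
  have := (h.mono (q := fun x => ∃ y : Zmin, Zmin.toQmin y = Qmin.scale D (Nat.cast_nonneg D) x ∧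
      |y.toInt| ≤ (W * D : ℕ)) (by
    intro x hx
    rw [Qmin.height] at hx
    obtain ⟨y, h1, h2⟩ := x.exists_scale_eq_toQmin D
      ((Nat.dvd_factorial (Rat.den_pos _) (by omega)).trans hD)
    refine ⟨y, h1, h2.trans ?_⟩
    exact_mod_cast Nat.mul_le_mul_right D hx)).exists_transfer
  obtain ⟨r', hc, hA, hb⟩ := this
  refine ⟨r', ?_, fun i => (hc i).2, fun i j => (hA i j).2, fun i => (hb i).2⟩
  rw [map, map, mk.injEq]
  exact ⟨funext fun i => (hc i).1, Matrix.ext fun i j => (hA i j).1, funext fun i => (hb i).1⟩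

/-- Denominators bounded by `W` divide `W !`, hence `D`. Scaling by `D` is an endomorphism of
`Qmin`, so it scales the recognized sequence along with the entries. -/
theorem Recognizes.exists_integral {r : Realization Qmin N} {S : ℕ → Qmin} (h : r.Recognizes S)
    {W : ℕ} (hW : r.Entries fun x => x.height ≤ W) (D : ℕ) (hD : W.factorial ∣ D) :
    ∃ (r' : Realization Zmin N) (S' : ℕ → Zmin), r'.Recognizes S' ∧ r'.AbsLe (W * D) ∧
      ∀ k, Zmin.toQmin (S' k) = Qmin.scale D (Nat.cast_nonneg D) (S k) := by
  obtain ⟨r', h1, h2⟩ := exists_map_scale_eq hW D hD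
  refine ⟨r', fun k => r'.c ⬝ᵥ (r'.A ^ k *ᵥ r'.b), fun k => rfl, h2, fun k => ?_⟩
  have h3 := (h.map (Qmin.scale D (Nat.cast_nonneg D))) k
  rw [← h1, map_eval] at h3
  exact h3.symm

/-- The number of terms which determine sequences realized over `Qmin`. -/
def ratEqualityBound (n W : ℕ) : ℕ := equalityBound n (W * W.factorial)

theorem Recognizes.eq_of_forall_lt_rat {N' : ℕ} {r : Realization Qmin N}
    {r' : Realization Qmin N'} {S S' : ℕ → Qmin} (h : r.Recognizes S) (h' : r'.Recognizes S')
    {n W : ℕ} (hn : N ≤ n) (hn' : N' ≤ n) (hW : r.Entries fun x => x.height ≤ W)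
    (hW' : r'.Entries fun x => x.height ≤ W) (heq : ∀ k < ratEqualityBound n W, S k = S' k) :
    S = S' := by
  obtain ⟨r₁, S₁, h1, h2, h3⟩ := h.exists_integral hW _ dvd_rfl
  obtain ⟨r₁', S₁', h1', h2', h3'⟩ := h'.exists_integral hW' _ dvd_rfl
  have := h1.eq_of_forall_lt h1' hn hn' h2 h2' fun k hk =>
    Zmin.toQmin_injective (by rw [h3, h3', heq k hk])
  funext k
  apply Qmin.scale_injective W.factorial (by exact_mod_cast W.factorial_pos)
  rw [← h3, ← h3', this]

/-- The bound on the heights of the entries of a small realization. -/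
def heightBound (n W : ℕ) : ℕ :=
  weightBound n (W * W.factorial) + W.factorial * weightBound n (W * W.factorial) + 1

theorem AbsLe.height_toQmin_le {r : Realization Zmin N} {n W : ℕ}
    (h : r.AbsLe (weightBound n (W * W.factorial))) :
    r.Entries fun x => (Zmin.toQmin x).height ≤ heightBound n W := by
  have key : ∀ x : Zmin, |x.toInt| ≤ weightBound n (W * W.factorial) →
      (Zmin.toQmin x).height ≤ heightBound n W := by
    intro x hx
    rw [Zmin.height_toQmin, heightBound]
    rw [Int.abs_eq_natAbs] at hx
    have : x.toInt.natAbs ≤ weightBound n (W * W.factorial) := by exact_mod_cast hx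
    omega
  exact ⟨fun i => key _ (h.1 i), fun i j => key _ (h.2.1 i j), fun i => key _ (h.2.2 i)⟩

theorem absLe_of_height_toQmin_le {r : Realization Zmin N} {W : ℕ}
    (h : r.Entries fun x => (Zmin.toQmin x).height ≤ W) : r.AbsLe (W * W.factorial) := by
  have key : ∀ x : Zmin, (Zmin.toQmin x).height ≤ W → |x.toInt| ≤ (W * W.factorial : ℕ) := by
    intro x hx
    rw [Zmin.height_toQmin] at hx
    rw [Int.abs_eq_natAbs]
    have : W ≤ W * W.factorial := Nat.le_mul_of_pos_right _ W.factorial_pos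
    exact_mod_cast (by omega : x.toInt.natAbs ≤ W * W.factorial)
  exact ⟨fun i => key _ (h.1 i), fun i j => key _ (h.2.1 i j), fun i => key _ (h.2.2 i)⟩

/-! ### Small realizations over the individual semirings -/

/-- Realizable sequences have small realizations of the same dimension. -/
def SmallRealizations {K : Type} [CommSemiring K] (φ : K →+* Qmin) : Prop :=
  ∀ {n W M N : ℕ} {S : ℕ → K} {r : Realization K M}, M ≤ n → N ≤ n →
    (r.Entries fun x => (φ x).height ≤ W) → r.Recognizes S → HasRealization S N →
    ∃ r' : Realization K N, r'.Recognizes S ∧ r'.Entries fun x => (φ x).height ≤ heightBound n W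

/-- With `t = 1`, the condition `0 < t' ≤ t` leaves only `t' = 1`. -/
theorem smallRealizations_Zmin : SmallRealizations Zmin.toQmin := by
  intro n W M N S r hM hN hW h ⟨r', h'⟩
  obtain ⟨t', r'', h1, h2, -, h3, h4, -⟩ := h.exists_small (r' := r') one_pos (by simpa using h')
    hM hN (absLe_of_height_toQmin_le hW)
  obtain rfl : t' = 1 := by omega
  exact ⟨r'', by simpa using h4, h3.height_toQmin_le⟩

/-- The denominators of the sought realization are not bounded in advance. Clearing them realizes a
power of the integral sequence `S₁`; `Recognizes.exists_small` bounds both a new exponent `t` and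
the weights, and division by `D * t` gives back `S` with bounded denominators. -/
theorem smallRealizations_Qmin : SmallRealizations (RingHom.id Qmin) := by
  intro n W M N S r hM hN hW h ⟨r', h'⟩
  simp only [RingHom.id_apply] at hW ⊢
  obtain ⟨r₁, S₁, h1, h2, h3⟩ := h.exists_integral hW _ dvd_rfl
  obtain ⟨W', hW'⟩ := r'.exists_entries_le Qmin.height
  set D := W.factorial
  have hDpos : 0 < D := W.factorial_pos
  obtain ⟨r₁', S₁', h1', -, h3'⟩ := h'.exists_integral hW' (D * W'.factorial) (dvd_mul_left _ _)
  have hS₁' : S₁' = fun k => S₁ k ^ W'.factorial := by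
    funext k
    apply Zmin.toQmin_injective
    rw [h3', map_pow, h3, Qmin.scale_natCast _ hDpos,
      Qmin.scale_natCast _ (Nat.mul_pos hDpos W'.factorial_pos), pow_mul]
  rw [hS₁'] at h1'
  obtain ⟨t, r₂, ht, -, htB, hB, h4, -⟩ := h1.exists_small W'.factorial_pos h1' hM hN h2
  have hDt : 0 < D * t := Nat.mul_pos hDpos ht
  have hinv : (0 : ℚ) ≤ ((D * t : ℕ) : ℚ)⁻¹ := by positivity
  have hcancel : ∀ x : Qmin, Qmin.scale _ hinv (x ^ (D * t)) = x := by
    intro x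
    rcases x.eq_zero_or_ofRat with rfl | ⟨q, rfl⟩
    · rw [zero_pow hDt.ne', map_zero]
    · rw [Qmin.ofRat_pow, Qmin.scale_ofRat, inv_mul_cancel_left₀]
      exact_mod_cast hDt.ne'
  refine ⟨(r₂.map Zmin.toQmin).map (Qmin.scale _ hinv), ?_, ?_⟩
  · have h5 := (h4.map Zmin.toQmin).map (Qmin.scale _ hinv)
    have : (fun k => Qmin.scale _ hinv (Zmin.toQmin (S₁ k ^ t))) = S := by
      funext k
      rw [map_pow, h3, Qmin.scale_natCast _ hDpos, ← pow_mul, hcancel]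
    rwa [this] at h5
  · have key : ∀ x : Zmin, |x.toInt| ≤ weightBound n (W * D) →
        (Qmin.scale _ hinv (Zmin.toQmin x)).height ≤ heightBound n W := by
      intro x hx
      by_cases h0 : x = 0
      · subst h0
        rw [map_zero, map_zero]
        change 0 + 1 ≤ _
        rw [heightBound]; omega
      · obtain ⟨m, rfl⟩ := Zmin.exists_eq_ofInt h0
        rw [Zmin.toInt_ofInt, Int.abs_eq_natAbs] at hx
        rw [Zmin.toQmin_ofInt, Qmin.scale_ofRat]
        change ((_ : ℚ) * (m : ℚ)).num.natAbs + ((_ : ℚ) * (m : ℚ)).den ≤ _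
        have e : ((D * t : ℕ) : ℚ)⁻¹ * (m : ℚ) = Rat.divInt m (D * t : ℕ) := by
          rw [Rat.divInt_eq_div, div_eq_inv_mul]; simp
        rw [e]
        have hDt' : ((D * t : ℕ) : ℤ) ≠ 0 := by exact_mod_cast hDt.ne'
        have e1 : (Rat.divInt m (D * t : ℕ)).den ≤ D * t := by
          have := Int.le_of_dvd (by exact_mod_cast hDt) (Rat.den_dvd m (D * t : ℕ))
          exact_mod_cast this
        have e2 : (Rat.divInt m (D * t : ℕ)).num.natAbs ≤ m.natAbs := by
          by_cases hm : m = 0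
          · simp [hm]
          · exact Nat.le_of_dvd (Int.natAbs_pos.2 hm)
              (Int.natAbs_dvd_natAbs.2 (Rat.num_dvd m hDt'))
        have e3 : m.natAbs ≤ weightBound n (W * D) := by exact_mod_cast hx
        have e4 := Nat.mul_le_mul_left D htB
        change _ ≤ weightBound n (W * D) + D * weightBound n (W * D) + 1
        omega
    exact ⟨fun i => key _ (hB.1 i), fun i j => key _ (hB.2.1 i j), fun i => key _ (hB.2.2 i)⟩

theorem SmallRealizations.of_bijective {K L : Type} [CommSemiring K] [CommSemiring L]
    {φ : L →+* Qmin} (h : SmallRealizations φ) (ψ : K →+* L) (hψ : Function.Bijective ψ) :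
    SmallRealizations (φ.comp ψ) := by
  intro n W M N S r hM hN hW hr ⟨r', h'⟩
  obtain ⟨r'', h1, h2⟩ := h (r := r.map ψ) hM hN ⟨hW.1, hW.2.1, hW.2.2⟩ (hr.map ψ) ⟨_, h'.map ψ⟩
  have h3 := (h2.mono (q := fun y => ∃ x : K, ψ x = y ∧ (φ (ψ x)).height ≤ heightBound n W) (by
    intro y hy
    obtain ⟨x, rfl⟩ := hψ.2 y
    exact ⟨x, rfl, hy⟩)).exists_transfer
  obtain ⟨r₁, hc, hA, hb⟩ := h3
  have e : r₁.map ψ = r'' := by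
    cases r''
    rw [map, mk.injEq]
    exact ⟨funext fun i => (hc i).1, Matrix.ext fun i j => (hA i j).1, funext fun i => (hb i).1⟩
  exact ⟨r₁, Recognizes.of_map hψ.1 (by rwa [e]),
    fun i => (hc i).2, fun i j => (hA i j).2, fun i => (hb i).2⟩

/-- The inclusion of `Nmin` into `Zmin`. -/
def _root_.Nmin.toZmin : Nmin →+* Zmin := Tropical.mapWithTop (Nat.castAddMonoidHom ℤ) Nat.mono_cast

theorem _root_.Nmin.toZmin_injective : Function.Injective Nmin.toZmin :=
  Tropical.mapWithTop_injective _ _ Nat.cast_injective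

theorem _root_.Nmin.toInt_toZmin_nonneg (x : Nmin) : 0 ≤ (Nmin.toZmin x).toInt := by
  induction x using Tropical.tropRec with
  | h x =>
    induction x using WithTop.recTopCoe with
    | top => exact le_rfl
    | coe q => exact Int.natCast_nonneg q

theorem _root_.Nmin.exists_toZmin_eq (y : Zmin) (hy : 0 ≤ y.toInt) : ∃ x, Nmin.toZmin x = y := by
  by_cases h0 : y = 0
  · exact ⟨0, by rw [map_zero, h0]⟩
  · obtain ⟨m, rfl⟩ := Zmin.exists_eq_ofInt h0
    obtain ⟨k, rfl⟩ := Int.eq_ofNat_of_zero_le hy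
    exact ⟨Tropical.trop (k : WithTop ℕ), rfl⟩

/-- The small integral realization inherits nonnegative weights from the given one, so it lies in
the image of `Nmin`. -/
theorem smallRealizations_Nmin : SmallRealizations (Zmin.toQmin.comp Nmin.toZmin) := by
  intro n W M N S r hM hN hW h ⟨r', h'⟩
  obtain ⟨t', r'', h1, h2, -, h3, h4, h5⟩ := (h.map Nmin.toZmin).exists_small
    (r' := r'.map Nmin.toZmin) one_pos (by simpa using h'.map Nmin.toZmin)
    hM hN (absLe_of_height_toQmin_le (W := W) ⟨hW.1, hW.2.1, hW.2.2⟩)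
  obtain rfl : t' = 1 := by omega
  have hnn := h5 (by rintro (i | e | i) <;> exact Nmin.toInt_toZmin_nonneg _)
  have hpre : r''.Entries fun y => ∃ x, Nmin.toZmin x = y :=
    ⟨fun i => Nmin.exists_toZmin_eq _ (hnn (.inl i)),
      fun i j => Nmin.exists_toZmin_eq _ (hnn (.inr (.inl (i, j)))),
      fun i => Nmin.exists_toZmin_eq _ (hnn (.inr (.inr i)))⟩
  obtain ⟨r₁, hc, hA, hb⟩ := hpre.exists_transfer
  have e : r'' = r₁.map Nmin.toZmin := by
    cases r''
    rw [map, mk.injEq]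
    exact ⟨funext fun i => (hc i).symm, Matrix.ext fun i j => (hA i j).symm,
      funext fun i => (hb i).symm⟩
  subst e
  have h6 := h3.height_toQmin_le
  exact ⟨r₁, Recognizes.of_map Nmin.toZmin_injective (by simpa using h4), h6.1, h6.2.1, h6.2.2⟩

end Realization

/-! ### Primitive recursiveness of the bounds -/

theorem Primrec.nat_pow : Primrec₂ fun a b : ℕ => a ^ b := by
  refine (Primrec.nat_rec' (f := fun p : ℕ × ℕ => p.2) (g := fun _ => 1)
    (h := fun p q => q.2 * p.1) snd (const 1) ?_).of_eq fun p => ?_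
  · exact (nat_mul.comp (snd.comp snd) (fst.comp fst)).to₂
  · induction p.2 with
    | zero => rfl
    | succ k ih => simp only [ih, pow_succ]

theorem Primrec.nat_factorial : Primrec Nat.factorial := by
  refine (Primrec.nat_rec₁ (f := fun k x => (k + 1) * x) 1 ?_).of_eq fun n => ?_
  · exact nat_mul.comp (succ.comp fst) snd
  · induction n with
    | zero => rfl
    | succ k ih => simp only [ih, Nat.factorial_succ]

theorem primrec_blockBound : Primrec₂ blockBound := by
  refine (Primrec.nat_rec' (f := fun p : ℕ × ℕ => p.2) (g := fun _ => 1)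
    (h := fun p q => (2 * (q.2 * p.1) + 1) * q.2) Primrec.snd (Primrec.const 1) ?_).of_eq
    fun p => ?_
  · have h1 : Primrec fun x : (ℕ × ℕ) × ℕ × ℕ => x.2.2 := Primrec.snd.comp Primrec.snd
    have h2 : Primrec fun x : (ℕ × ℕ) × ℕ × ℕ => x.1.1 := Primrec.fst.comp Primrec.fst
    exact Primrec.nat_mul.comp
      (Primrec.succ.comp (Primrec.nat_mul.comp (Primrec.const 2) (Primrec.nat_mul.comp h1 h2))) h1
  · rfl

theorem primrec_pumpLength : Primrec EdgeWalk.pumpLength := by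
  have h1 : Primrec fun n : ℕ => n + 1 := Primrec.succ
  exact Primrec.nat_add.comp (Primrec.nat_pow.comp h1 (Primrec.const 2))
    (Primrec.nat_mul.comp Primrec.id (Primrec.nat_mul.comp
      (Primrec.nat_pow.comp h1 (Primrec.nat_mul.comp Primrec.id Primrec.id)) Primrec.nat_factorial))

namespace Realization

theorem primrec_cycleStart : Primrec₂ cycleStart := by
  have hf : Primrec fun p : ℕ × ℕ => p.1.factorial := Primrec.nat_factorial.comp Primrec.fst
  have hT : Primrec fun p : ℕ × ℕ => EdgeWalk.pumpLength p.1 + p.1.factorial :=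
    Primrec.nat_add.comp (primrec_pumpLength.comp Primrec.fst) hf
  exact Primrec.nat_add.comp hT (Primrec.nat_mul.comp hf (Primrec.succ.comp (Primrec.nat_add.comp
    (Primrec.nat_mul.comp (Primrec.nat_mul.comp (Primrec.const 2) Primrec.snd)
      (Primrec.nat_add.comp hT (Primrec.const 2)))
    (Primrec.nat_mul.comp hT (Primrec.nat_mul.comp Primrec.snd hf)))))

theorem primrec_equalityBound : Primrec₂ equalityBound :=
  Primrec.nat_add.comp primrec_cycleStart (Primrec.nat_mul.comp (Primrec.const 2)
    (Primrec.nat_factorial.comp Primrec.fst))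

theorem primrec_runBound : Primrec₂ runBound :=
  Primrec.nat_add.comp (Primrec.nat_add.comp (primrec_pumpLength.comp Primrec.fst)
    (Primrec.nat_factorial.comp Primrec.fst)) primrec_cycleStart

theorem primrec_coeffBound : Primrec₂ coeffBound :=
  Primrec.nat_mul.comp (Primrec.succ.comp Primrec.snd)
    (Primrec.nat_add.comp primrec_runBound (Primrec.const 2))

theorem primrec_weightBound : Primrec₂ weightBound := by
  have hn : Primrec fun p : ℕ × ℕ => p.1 := Primrec.fst
  exact primrec_blockBound.comp (Primrec.succ.comp primrec_coeffBound) (Primrec.nat_pow.comp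
    (Primrec.succ.comp (Primrec.nat_mul.comp (Primrec.const 2) primrec_coeffBound))
    (Primrec.succ.comp (Primrec.nat_add.comp (Primrec.nat_mul.comp hn hn)
      (Primrec.nat_mul.comp (Primrec.const 2) hn))))

theorem primrec_heightBound : Primrec₂ heightBound := by
  have hf : Primrec fun p : ℕ × ℕ => p.2.factorial := Primrec.nat_factorial.comp Primrec.snd
  have hw : Primrec fun p : ℕ × ℕ => weightBound p.1 (p.2 * p.2.factorial) :=
    primrec_weightBound.comp Primrec.fst (Primrec.nat_mul.comp Primrec.snd hf)
  exact Primrec.succ.comp (Primrec.nat_add.comp hw (Primrec.nat_mul.comp hf hw))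

theorem primrec_ratEqualityBound : Primrec₂ ratEqualityBound :=
  primrec_equalityBound.comp Primrec.fst (Primrec.nat_mul.comp Primrec.snd
    (Primrec.nat_factorial.comp Primrec.snd))

end Realization

/-! ### Computing with represented rationals and triples -/

/-- Representations of elements of `Qmin`: `none` for `∞`, and `(a, b, d)` for the rational
`(a - b) / (d + 1)`. -/
abbrev QminRep : Type := Option (ℕ × ℕ × ℕ)

namespace QminRep

/-- The element given by a representation. -/
def val : QminRep → Qmin
  | none => 0
  | some (a, b, d) => Qmin.ofRat (((a : ℚ) - b) / (d + 1))

/-- The order of represented rationals, by cross-multiplication. -/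
def ratLe (x y : ℕ × ℕ × ℕ) : Prop :=
  x.1 * (y.2.2 + 1) + y.2.1 * (x.2.2 + 1) ≤ y.1 * (x.2.2 + 1) + x.2.1 * (y.2.2 + 1)

instance : DecidableRel ratLe := fun _ _ => Nat.decLe _ _

/-- The sum of represented rationals. -/
def ratAdd (x y : ℕ × ℕ × ℕ) : ℕ × ℕ × ℕ :=
  (x.1 * (y.2.2 + 1) + y.1 * (x.2.2 + 1), x.2.1 * (y.2.2 + 1) + y.2.1 * (x.2.2 + 1),
    -- Denominators are stored minus one: this is `(d + 1) * (d' + 1) - 1`.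
    x.2.2 * y.2.2 + x.2.2 + y.2.2)

/-- Tropical addition of representations. -/
def add (x y : QminRep) : QminRep :=
  x.elim y fun p => y.elim (some p) fun q => if ratLe p q then some p else some q

/-- Tropical multiplication of representations. -/
def mul (x y : QminRep) : QminRep :=
  x.bind fun p => y.map fun q => ratAdd p q

/-- Equality test for the represented elements. -/
def eqv (x y : QminRep) : Bool :=
  x.elim (y.elim true fun _ => false) fun p =>
    y.elim false fun q => decide (ratLe p q) && decide (ratLe q p)

/-- A bound on the height of the represented element. -/
def height (x : QminRep) : ℕ := x.elim 1 fun p => p.1 + p.2.1 + p.2.2 + 1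

theorem ratLe_iff (x y : ℕ × ℕ × ℕ) : ratLe x y ↔
    ((x.1 : ℚ) - x.2.1) / (x.2.2 + 1) ≤ ((y.1 : ℚ) - y.2.1) / (y.2.2 + 1) := by
  rw [div_le_div_iff₀ (by positivity) (by positivity), ratLe, ← Nat.cast_le (α := ℚ)]
  push_cast
  constructor <;> intro h <;> linarith

theorem val_add (x y : QminRep) : val (add x y) = val x + val y := by
  rcases x with _ | ⟨p⟩
  · exact (zero_add _).symm
  rcases y with _ | ⟨q⟩
  · exact (add_zero _).symm
  have key : ∀ u v : ℚ, u ≤ v → Qmin.ofRat u ≤ Qmin.ofRat v := fun u v h => by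
    rw [← Tropical.untrop_le_iff]
    exact WithTop.coe_le_coe.2 h
  by_cases h : ratLe p q
  · simp only [add, Option.elim, if_pos h]
    exact (Tropical.add_eq_left (key _ _ ((ratLe_iff p q).1 h))).symm
  · simp only [add, Option.elim, if_neg h]
    rw [ratLe_iff, not_le] at h
    exact (Tropical.add_eq_right (key _ _ h.le)).symm

theorem val_mul (x y : QminRep) : val (mul x y) = val x * val y := by
  rcases x with _ | ⟨p⟩
  · exact (zero_mul _).symm
  rcases y with _ | ⟨q⟩
  · exact (mul_zero _).symm
  refine congrArg Qmin.ofRat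
    (?_ : _ = ((p.1 : ℚ) - p.2.1) / (p.2.2 + 1) + ((q.1 : ℚ) - q.2.1) / (q.2.2 + 1))
  push_cast
  have h1 : (p.2.2 : ℚ) + 1 ≠ 0 := by positivity
  have h2 : (q.2.2 : ℚ) + 1 ≠ 0 := by positivity
  have h3 : (p.2.2 : ℚ) * q.2.2 + p.2.2 + q.2.2 + 1 = (p.2.2 + 1) * (q.2.2 + 1) := by ring
  rw [h3]
  field_simp
  ring

theorem ofRat_ne_zero (q : ℚ) : Qmin.ofRat q ≠ 0 := fun h =>
  WithTop.coe_ne_top (congrArg Tropical.untrop h)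

theorem eqv_iff (x y : QminRep) : eqv x y = true ↔ val x = val y := by
  rcases x with _ | ⟨p⟩ <;> rcases y with _ | ⟨q⟩
  · simp [eqv]
  · simpa [eqv, val] using (ofRat_ne_zero _).symm
  · simpa [eqv, val] using ofRat_ne_zero _
  · simp only [eqv, Option.elim, Bool.and_eq_true, decide_eq_true_eq, ratLe_iff]
    rw [← le_antisymm_iff]
    constructor
    · intro h
      exact congrArg Qmin.ofRat h
    · intro h
      exact congrArg Qmin.toRat h

/-- Reducing a fraction does not increase its numerator or denominator in absolute value. -/
theorem height_val_le (x : QminRep) : (val x).height ≤ height x := by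
  rcases x with _ | ⟨a, b, d⟩
  · exact le_rfl
  · change (((a : ℚ) - b) / (d + 1)).num.natAbs + (((a : ℚ) - b) / (d + 1)).den ≤ a + b + d + 1
    have e : ((a : ℚ) - b) / (d + 1) = Rat.divInt (a - b) (d + 1 : ℕ) := by
      rw [Rat.divInt_eq_div]; push_cast; rfl
    rw [e]
    have e1 : (Rat.divInt (a - b) (d + 1 : ℕ)).den ≤ d + 1 := by
      have := Int.le_of_dvd (by positivity) (Rat.den_dvd (a - b) (d + 1 : ℕ))
      exact_mod_cast this
    have e2 : (Rat.divInt (a - b) (d + 1 : ℕ)).num.natAbs ≤ ((a : ℤ) - b).natAbs := by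
      by_cases hm : (a : ℤ) - b = 0
      · simp [hm]
      · exact Nat.le_of_dvd (Int.natAbs_pos.2 hm)
          (Int.natAbs_dvd_natAbs.2 (Rat.num_dvd _ (by positivity)))
    omega

theorem primrecRel_ratLe : PrimrecRel ratLe := by
  have x1 : Primrec fun p : (ℕ × ℕ × ℕ) × (ℕ × ℕ × ℕ) => p.1.1 := Primrec.fst.comp Primrec.fst
  have x2 : Primrec fun p : (ℕ × ℕ × ℕ) × (ℕ × ℕ × ℕ) => p.1.2.1 :=
    Primrec.fst.comp (Primrec.snd.comp Primrec.fst)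
  have x3 : Primrec fun p : (ℕ × ℕ × ℕ) × (ℕ × ℕ × ℕ) => p.1.2.2 + 1 :=
    Primrec.succ.comp (Primrec.snd.comp (Primrec.snd.comp Primrec.fst))
  have y1 : Primrec fun p : (ℕ × ℕ × ℕ) × (ℕ × ℕ × ℕ) => p.2.1 := Primrec.fst.comp Primrec.snd
  have y2 : Primrec fun p : (ℕ × ℕ × ℕ) × (ℕ × ℕ × ℕ) => p.2.2.1 :=
    Primrec.fst.comp (Primrec.snd.comp Primrec.snd)
  have y3 : Primrec fun p : (ℕ × ℕ × ℕ) × (ℕ × ℕ × ℕ) => p.2.2.2 + 1 :=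
    Primrec.succ.comp (Primrec.snd.comp (Primrec.snd.comp Primrec.snd))
  exact Primrec.nat_le.comp
    (Primrec.nat_add.comp (Primrec.nat_mul.comp x1 y3) (Primrec.nat_mul.comp y2 x3))
    (Primrec.nat_add.comp (Primrec.nat_mul.comp y1 x3) (Primrec.nat_mul.comp x2 y3))

theorem primrec_ratAdd : Primrec₂ ratAdd := by
  have x1 : Primrec fun p : (ℕ × ℕ × ℕ) × (ℕ × ℕ × ℕ) => p.1.1 := Primrec.fst.comp Primrec.fst
  have x2 : Primrec fun p : (ℕ × ℕ × ℕ) × (ℕ × ℕ × ℕ) => p.1.2.1 :=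
    Primrec.fst.comp (Primrec.snd.comp Primrec.fst)
  have x3 : Primrec fun p : (ℕ × ℕ × ℕ) × (ℕ × ℕ × ℕ) => p.1.2.2 :=
    Primrec.snd.comp (Primrec.snd.comp Primrec.fst)
  have y1 : Primrec fun p : (ℕ × ℕ × ℕ) × (ℕ × ℕ × ℕ) => p.2.1 := Primrec.fst.comp Primrec.snd
  have y2 : Primrec fun p : (ℕ × ℕ × ℕ) × (ℕ × ℕ × ℕ) => p.2.2.1 :=
    Primrec.fst.comp (Primrec.snd.comp Primrec.snd)
  have y3 : Primrec fun p : (ℕ × ℕ × ℕ) × (ℕ × ℕ × ℕ) => p.2.2.2 :=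
    Primrec.snd.comp (Primrec.snd.comp Primrec.snd)
  have x3' := Primrec.succ.comp x3
  have y3' := Primrec.succ.comp y3
  exact Primrec.pair (Primrec.nat_add.comp (Primrec.nat_mul.comp x1 y3') (Primrec.nat_mul.comp y1 x3'))
    (Primrec.pair
      (Primrec.nat_add.comp (Primrec.nat_mul.comp x2 y3') (Primrec.nat_mul.comp y2 x3'))
      (Primrec.nat_add.comp (Primrec.nat_add.comp (Primrec.nat_mul.comp x3 y3) x3) y3))

theorem _root_.Primrec.option_elim {α β σ : Type*} [Primcodable α] [Primcodable β] [Primcodable σ]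
    {o : α → Option β} {f : α → σ} {g : α → β → σ} (ho : Primrec o) (hf : Primrec f)
    (hg : Primrec₂ g) : Primrec fun a => (o a).elim (f a) (g a) :=
  (Primrec.option_casesOn ho hf hg).of_eq fun a => by cases o a <;> rfl

theorem primrec_add : Primrec₂ add := by
  refine Primrec.option_elim (o := fun p : QminRep × QminRep => p.1) Primrec.fst Primrec.snd ?_
  refine Primrec.option_elim (o := fun p : (QminRep × QminRep) × (ℕ × ℕ × ℕ) => p.1.2)
    (Primrec.snd.comp Primrec.fst) (Primrec.option_some.comp Primrec.snd) ?_
  exact Primrec.ite (primrecRel_ratLe.comp (Primrec.snd.comp Primrec.fst) Primrec.snd)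
    (Primrec.option_some.comp (Primrec.snd.comp Primrec.fst)) (Primrec.option_some.comp Primrec.snd)

theorem primrec_mul : Primrec₂ mul := by
  refine Primrec.option_bind (f := fun p : QminRep × QminRep => p.1) Primrec.fst ?_
  refine Primrec.option_map (f := fun p : (QminRep × QminRep) × (ℕ × ℕ × ℕ) => p.1.2)
    (Primrec.snd.comp Primrec.fst) ?_
  exact primrec_ratAdd.comp (Primrec.snd.comp Primrec.fst) Primrec.snd

theorem primrec_eqv : Primrec₂ eqv := by
  refine Primrec.option_elim (o := fun p : QminRep × QminRep => p.1) Primrec.fst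
    (Primrec.option_elim Primrec.snd (Primrec.const true) (Primrec.const false).to₂) ?_
  refine Primrec.option_elim (o := fun p : (QminRep × QminRep) × (ℕ × ℕ × ℕ) => p.1.2)
    (Primrec.snd.comp Primrec.fst) (Primrec.const false) ?_
  have h1 : Primrec fun p : ((QminRep × QminRep) × (ℕ × ℕ × ℕ)) × (ℕ × ℕ × ℕ) => p.1.2 :=
    Primrec.snd.comp Primrec.fst
  exact Primrec.and.comp (primrecRel_ratLe.comp h1 Primrec.snd).decide
    (primrecRel_ratLe.comp Primrec.snd h1).decide

theorem primrec_height : Primrec height := by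
  refine Primrec.option_elim Primrec.id (Primrec.const 1) ?_
  have h : Primrec fun p : QminRep × (ℕ × ℕ × ℕ) => p.2 := Primrec.snd
  exact Primrec.succ.comp (Primrec.nat_add.comp (Primrec.nat_add.comp (Primrec.fst.comp h)
    (Primrec.fst.comp (Primrec.snd.comp h))) (Primrec.snd.comp (Primrec.snd.comp h)))

end QminRep

namespace QminRep

/-- The scalar product of two lists of representations. -/
def dot (u v : List QminRep) : QminRep :=
  (List.range u.length).foldl (fun s i => add s (mul (u.getD i none) (v.getD i none))) none

/-- The action of a list of rows on a list of representations. -/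
def mulVec (A : List (List QminRep)) (v : List QminRep) : List QminRep := A.map fun u => dot u v

/-- The `k`-th term of the sequence recognized by an encoded triple. -/
def eval (p : RealizationCode QminRep) (k : ℕ) : QminRep :=
  dot p.2.1 ((mulVec p.2.2.1)^[k] p.2.2.2)

/-- A bound on the heights of the entries of an encoded triple. -/
def codeHeight (p : RealizationCode QminRep) : ℕ :=
  (p.2.1 ++ p.2.2.1.flatten ++ p.2.2.2).foldr (fun x s => x.height + s) 0

/-- Two encoded triples recognize sequences with the same first `G` terms. -/
def agree (p q : RealizationCode QminRep) (G : ℕ) : Bool :=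
  (List.range G).foldr (fun k s => eqv (eval p k) (eval q k) && s) true

theorem primrec_dot : Primrec₂ dot := by
  refine Primrec.list_foldl (f := fun p : List QminRep × List QminRep => List.range p.1.length)
    (g := fun _ => (none : QminRep))
    (h := fun p q => add q.1 (mul (p.1.getD q.2 none) (p.2.getD q.2 none)))
    (Primrec.list_range.comp (Primrec.list_length.comp Primrec.fst)) (Primrec.const none) ?_
  have hi : Primrec fun x : (List QminRep × List QminRep) × (QminRep × ℕ) => x.2.2 :=
    Primrec.snd.comp Primrec.snd
  exact primrec_add.comp (Primrec.fst.comp Primrec.snd) (primrec_mul.comp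
    ((Primrec.list_getD none).comp (Primrec.fst.comp Primrec.fst) hi)
    ((Primrec.list_getD none).comp (Primrec.snd.comp Primrec.fst) hi))

theorem primrec_mulVec : Primrec₂ mulVec :=
  Primrec.list_map Primrec.fst (primrec_dot.comp Primrec.snd (Primrec.snd.comp Primrec.fst))

theorem primrec_eval : Primrec₂ eval := by
  have hp : Primrec fun x : RealizationCode QminRep × ℕ => x.1.2 := Primrec.snd.comp Primrec.fst
  refine primrec_dot.comp (Primrec.fst.comp hp) (Primrec.nat_iterate Primrec.snd
    (Primrec.snd.comp (Primrec.snd.comp hp)) ?_)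
  exact primrec_mulVec.comp (Primrec.fst.comp (Primrec.snd.comp (hp.comp Primrec.fst))) Primrec.snd

theorem primrec_codeHeight : Primrec codeHeight := by
  have hp : Primrec fun x : RealizationCode QminRep => x.2 := Primrec.snd
  refine Primrec.list_foldr (h := fun _ q => q.1.height + q.2)
    (Primrec.list_append.comp (Primrec.list_append.comp (Primrec.fst.comp hp)
      (Primrec.list_flatten.comp (Primrec.fst.comp (Primrec.snd.comp hp))))
      (Primrec.snd.comp (Primrec.snd.comp hp))) (Primrec.const 0) ?_
  exact Primrec.nat_add.comp (primrec_height.comp (Primrec.fst.comp Primrec.snd))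
    (Primrec.snd.comp Primrec.snd)

theorem primrec_agree : Primrec fun x : (RealizationCode QminRep × RealizationCode QminRep) × ℕ =>
    agree x.1.1 x.1.2 x.2 := by
  have h1 : Primrec fun x : ((RealizationCode QminRep × RealizationCode QminRep) × ℕ) × (ℕ × Bool) =>
    x.1.1 := Primrec.fst.comp Primrec.fst
  have h2 : Primrec fun x : ((RealizationCode QminRep × RealizationCode QminRep) × ℕ) × (ℕ × Bool) =>
    x.2.1 := Primrec.fst.comp Primrec.snd
  have h3 : Primrec fun x : ((RealizationCode QminRep × RealizationCode QminRep) × ℕ) × (ℕ × Bool) =>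
    eval x.1.1.1 x.2.1 := primrec_eval.comp (Primrec.fst.comp h1) h2
  have h4 : Primrec fun x : ((RealizationCode QminRep × RealizationCode QminRep) × ℕ) × (ℕ × Bool) =>
    eval x.1.1.2 x.2.1 := primrec_eval.comp (Primrec.snd.comp h1) h2
  exact Primrec.list_foldr
    (f := fun x : (RealizationCode QminRep × RealizationCode QminRep) × ℕ => List.range x.2)
    (g := fun _ => true)
    (h := fun x q => eqv (eval x.1.1 q.1) (eval x.1.2 q.1) && q.2)
    (Primrec.list_range.comp Primrec.snd) (Primrec.const true)
    (Primrec.and.comp (primrec_eqv.comp h3 h4) (Primrec.snd.comp Primrec.snd)).to₂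

theorem agree_iff (p q : RealizationCode QminRep) (G : ℕ) :
    agree p q G = true ↔ ∀ k < G, val (eval p k) = val (eval q k) := by
  have : ∀ l : List ℕ, l.foldr (fun k s => eqv (eval p k) (eval q k) && s) true = true ↔
      ∀ k ∈ l, val (eval p k) = val (eval q k) := by
    intro l
    induction l with
    | nil => simp
    | cons k l ih => simp [ih, eqv_iff]
  simpa [agree] using this (List.range G)

theorem val_dot {N : ℕ} (w w' : Fin N → QminRep) :
    val (dot (List.ofFn w) (List.ofFn w')) = (fun i => val (w i)) ⬝ᵥ fun i => val (w' i) := by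
  have h : ∀ (u v : List QminRep) (n : ℕ),
      val ((List.range n).foldl (fun s i => add s (mul (u.getD i none) (v.getD i none))) none) =
        ∑ i ∈ Finset.range n, val (u.getD i none) * val (v.getD i none) := by
    intro u v n
    induction n with
    | zero => rfl
    | succ n ih =>
      rw [List.range_succ, List.foldl_append, Finset.sum_range_succ, ← ih]
      simp only [List.foldl_cons, List.foldl_nil, val_add, val_mul]
  rw [dot, h, List.length_ofFn, Finset.sum_range, dotProduct]
  refine Finset.sum_congr rfl fun i _ => ?_
  simp

theorem mulVec_ofFn {N : ℕ} (M : Fin N → Fin N → QminRep) (w : Fin N → QminRep) :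
    mulVec (List.ofFn fun i => List.ofFn (M i)) (List.ofFn w) =
      List.ofFn fun i => dot (List.ofFn (M i)) (List.ofFn w) := by
  rw [mulVec, List.map_ofFn]; rfl

theorem val_eval {N : ℕ} {r : Realization Qmin N} {S : ℕ → Qmin} (h : r.Recognizes S)
    (r₀ : Realization QminRep N) (hc : ∀ i, val (r₀.c i) = r.c i)
    (hA : ∀ i j, val (r₀.A i j) = r.A i j) (hb : ∀ i, val (r₀.b i) = r.b i) (k : ℕ) :
    val (eval (r₀.code id) k) = S k := by
  have hiter : ∃ w : Fin N → QminRep,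
      (mulVec (List.ofFn fun i => List.ofFn (r₀.A i)))^[k] (List.ofFn r₀.b) = List.ofFn w ∧
        (fun i => val (w i)) = r.A ^ k *ᵥ r.b := by
    induction k with
    | zero => exact ⟨r₀.b, rfl, by simpa using funext hb⟩
    | succ k ih =>
      obtain ⟨w, h1, h2⟩ := ih
      refine ⟨fun i => dot (List.ofFn (r₀.A i)) (List.ofFn w), ?_, ?_⟩
      · rw [Function.iterate_succ_apply', h1]
        exact mulVec_ofFn r₀.A w
      · funext i
        rw [val_dot, h2, pow_succ', ← Matrix.mulVec_mulVec]
        simp only [hA]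
        rfl
  obtain ⟨w, h1, h2⟩ := hiter
  change val (dot (List.ofFn r₀.c) ((mulVec (List.ofFn fun i => List.ofFn (r₀.A i)))^[k]
    (List.ofFn r₀.b))) = _
  rw [h1, val_dot, h2, h k]
  simp only [hc]

theorem height_le_codeHeight {N : ℕ} (r₀ : Realization QminRep N) :
    r₀.Entries fun x => (val x).height ≤ codeHeight (r₀.code id) := by
  have h : ∀ (l : List QminRep), ∀ x ∈ l, x.height ≤ l.foldr (fun x s => x.height + s) 0 := by
    intro l
    induction l with
    | nil => simp
    | cons y l ih =>
      intro x hx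
      rcases List.mem_cons.1 hx with rfl | hx
      · simp
      · exact (ih x hx).trans (by simp)
  have key : ∀ x, x ∈ (r₀.code id).2.1 ++ (r₀.code id).2.2.1.flatten ++ (r₀.code id).2.2.2 →
      (val x).height ≤ codeHeight (r₀.code id) := fun x hx => (height_val_le x).trans (h _ x hx)
  refine ⟨fun i => key _ ?_, fun i j => key _ ?_, fun i => key _ ?_⟩
  · simp [Realization.code]
  · simp only [List.mem_append, List.mem_flatten]
    refine Or.inl (Or.inr ⟨List.ofFn (r₀.A i), ?_, ?_⟩)
    · simp only [Realization.code, List.mem_ofFn]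
      exact ⟨i, rfl⟩
    · exact List.mem_ofFn.2 ⟨j, rfl⟩
  · simp [Realization.code]

end QminRep

/-! ### Enumeration of encoded triples -/

/-- All lists of length `n` over a list `E`. -/
def listsOfLength {κ : Type} (E : List κ) (n : ℕ) : List (List κ) :=
  Nat.rec [[]] (fun _ L => L.flatMap fun l => E.map fun e => e :: l) n

theorem mem_listsOfLength {κ : Type} (E : List κ) (n : ℕ) (l : List κ) :
    l ∈ listsOfLength E n ↔ l.length = n ∧ ∀ x ∈ l, x ∈ E := by
  induction n generalizing l with
  | zero =>
    change l ∈ [[]] ↔ _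
    rw [List.mem_singleton, List.length_eq_zero_iff]
    constructor
    · rintro rfl; simp
    · exact fun h => h.1
  | succ n ih =>
    change l ∈ (listsOfLength E n).flatMap (fun l => E.map fun e => e :: l) ↔ _
    simp only [List.mem_flatMap, List.mem_map]
    constructor
    · rintro ⟨l', hl', e, he, rfl⟩
      obtain ⟨h1, h2⟩ := (ih l').1 hl'
      exact ⟨by simp [h1], by simpa [he] using h2⟩
    · rintro ⟨h1, h2⟩
      rcases l with _ | ⟨e, l⟩
      · simp at h1
      · exact ⟨l, (ih l).2 ⟨by simpa using h1, fun x hx => h2 x (List.mem_cons_of_mem _ hx)⟩,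
          e, h2 e (by simp), rfl⟩

theorem primrec_listsOfLength {κ : Type} [Primcodable κ] :
    Primrec₂ (listsOfLength : List κ → ℕ → List (List κ)) := by
  refine Primrec.nat_rec' (f := fun p : List κ × ℕ => p.2) (g := fun _ => [[]])
    (h := fun p q => q.2.flatMap fun l => p.1.map fun e => e :: l) Primrec.snd (Primrec.const _) ?_
  refine Primrec.list_flatMap (Primrec.snd.comp Primrec.snd) ?_
  refine Primrec.list_map (Primrec.fst.comp (Primrec.fst.comp Primrec.fst)) ?_
  exact Primrec.list_cons.comp Primrec.snd (Primrec.snd.comp Primrec.fst)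

/-- All encoded triples of dimension `N` with entries in the list `E`. -/
def triples {κ : Type} (E : List κ) (N : ℕ) : List (RealizationCode κ) :=
  (listsOfLength E N).flatMap fun c => (listsOfLength (listsOfLength E N) N).flatMap fun A =>
    (listsOfLength E N).map fun b => (N, c, A, b)

theorem mem_triples {κ : Type} (E : List κ) (N : ℕ) (q : RealizationCode κ) :
    q ∈ triples E N ↔ q.1 = N ∧ q.2.1 ∈ listsOfLength E N ∧
      q.2.2.1 ∈ listsOfLength (listsOfLength E N) N ∧ q.2.2.2 ∈ listsOfLength E N := by
  obtain ⟨n, c, A, b⟩ := q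
  simp only [triples, List.mem_flatMap, List.mem_map, Prod.mk.injEq]
  constructor
  · rintro ⟨c, hc, A, hA, b, hb, rfl, rfl, rfl, rfl⟩
    exact ⟨rfl, hc, hA, hb⟩
  · rintro ⟨rfl, hc, hA, hb⟩
    exact ⟨c, hc, A, hA, b, hb, rfl, rfl, rfl, rfl⟩

theorem primrec_triples {κ : Type} [Primcodable κ] :
    Primrec₂ (triples : List κ → ℕ → List (RealizationCode κ)) := by
  have hE : Primrec fun p : List κ × ℕ => listsOfLength p.1 p.2 := primrec_listsOfLength
  refine Primrec.list_flatMap hE ?_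
  refine Primrec.list_flatMap ((primrec_listsOfLength.comp hE Primrec.snd).comp Primrec.fst) ?_
  refine Primrec.list_map (hE.comp (Primrec.fst.comp Primrec.fst)) ?_
  exact Primrec.pair (Primrec.snd.comp (Primrec.fst.comp (Primrec.fst.comp Primrec.fst)))
    (Primrec.pair (Primrec.snd.comp (Primrec.fst.comp Primrec.fst))
      (Primrec.pair (Primrec.snd.comp Primrec.fst) Primrec.snd))

theorem exists_ofFn_eq {κ K : Type} {enc : K → κ} {E : List κ} (hE : ∀ y ∈ E, ∃ x, enc x = y)
    {N : ℕ} {l : List κ} (hl : l ∈ listsOfLength E N) : ∃ u : Fin N → K, l = List.ofFn (enc ∘ u) := by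
  obtain ⟨rfl, h⟩ := (mem_listsOfLength E N l).1 hl
  choose u hu using fun i : Fin l.length => hE (l.get i) (h _ (List.get_mem l i))
  exact ⟨u, by rw [show enc ∘ u = l.get from funext hu, List.ofFn_get]⟩

theorem exists_code_eq {κ K : Type} {enc : K → κ} {E : List κ} (hE : ∀ y ∈ E, ∃ x, enc x = y)
    {N : ℕ} {q : RealizationCode κ} (hq : q ∈ triples E N) :
    ∃ r : Realization K N, r.code enc = q := by
  obtain ⟨h1, h2, h3, h4⟩ := (mem_triples E N q).1 hq
  obtain ⟨c, hc⟩ := exists_ofFn_eq hE h2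
  obtain ⟨b, hb⟩ := exists_ofFn_eq hE h4
  -- Decoding in two stages: the rows themselves serve as the encoded elements of the outer list.
  obtain ⟨A, hA⟩ := exists_ofFn_eq (enc := fun u : Fin N → K => List.ofFn (enc ∘ u))
    (fun y hy => by
      obtain ⟨u, hu⟩ := exists_ofFn_eq hE hy
      exact ⟨u, hu.symm⟩) h3
  obtain ⟨n, c', A', b'⟩ := q
  simp only at h1 hc hb hA
  subst h1 hc hb hA
  exact ⟨⟨c, .of A, b⟩, rfl⟩

theorem code_mem_triples {κ K : Type} {enc : K → κ} {E : List κ} {N : ℕ} {r : Realization K N}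
    (hr : r.Entries fun x => enc x ∈ E) : r.code enc ∈ triples E N := by
  have h : ∀ u : Fin N → K, (∀ i, enc (u i) ∈ E) →
      (List.ofFn fun i => enc (u i)) ∈ listsOfLength E N := by
    intro u hu
    rw [mem_listsOfLength]
    refine ⟨List.length_ofFn, fun x hx => ?_⟩
    obtain ⟨i, rfl⟩ := List.mem_ofFn.1 hx
    exact hu i
  rw [mem_triples]
  refine ⟨rfl, h _ hr.1, ?_, h _ hr.2.2⟩
  rw [mem_listsOfLength]
  refine ⟨List.length_ofFn, fun x hx => ?_⟩
  obtain ⟨i, rfl⟩ := List.mem_ofFn.1 hx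
  exact h _ (hr.2.1 i)

/-! ### The search algorithm -/

/-- An effective embedding of a semiring `K` into `Qmin`, with a list of representations of the
elements of bounded height. -/
structure EffectiveEmbedding {K κ : Type} [CommSemiring K] [Primcodable κ] (enc : K → κ) where
  /-- the embedding -/
  toQmin : K →+* Qmin
  injective : Function.Injective toQmin
  /-- the translation of representations -/
  rep : κ → QminRep
  primrec_rep : Primrec rep
  val_rep : ∀ x, (rep (enc x)).val = toQmin x
  /-- representations of elements, among them those of all elements of bounded height -/
  elements : ℕ → List κ
  primrec_elements : Primrec elements
  exists_of_mem : ∀ B, ∀ y ∈ elements B, ∃ x, enc x = y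
  mem_elements : ∀ B x, (toQmin x).height ≤ B → enc x ∈ elements B
  small : Realization.SmallRealizations toQmin

namespace EffectiveEmbedding

variable {K κ : Type} [CommSemiring K] [Primcodable κ] {enc : K → κ} (E : EffectiveEmbedding enc)

/-- The translation of encoded triples. -/
def repCode (p : RealizationCode κ) : RealizationCode QminRep :=
  (p.1, p.2.1.map E.rep, p.2.2.1.map fun l => l.map E.rep, p.2.2.2.map E.rep)

theorem primrec_repCode : Primrec E.repCode := by
  have hr : Primrec₂ fun (_ : RealizationCode κ) (x : κ) => E.rep x :=
    E.primrec_rep.comp Primrec.snd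
  have hp : Primrec fun p : RealizationCode κ => p.2 := Primrec.snd
  refine Primrec.pair Primrec.fst (Primrec.pair (Primrec.list_map (Primrec.fst.comp hp) hr)
    (Primrec.pair (Primrec.list_map (Primrec.fst.comp (Primrec.snd.comp hp)) ?_)
      (Primrec.list_map (Primrec.snd.comp (Primrec.snd.comp hp)) hr)))
  exact Primrec.list_map Primrec.snd (E.primrec_rep.comp Primrec.snd)

/-- The entrywise representation of a triple. -/
def repTriple {N : ℕ} (r : Realization K N) : Realization QminRep N where
  c i := E.rep (enc (r.c i))
  A := .of fun i j => E.rep (enc (r.A i j))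
  b i := E.rep (enc (r.b i))

theorem repCode_code {N : ℕ} (r : Realization K N) :
    E.repCode (r.code enc) = (E.repTriple r).code id := by
  simp only [repCode, Realization.code, repTriple, List.map_ofFn, id]
  refine congrArg (Prod.mk N) (congrArg₂ Prod.mk rfl (congrArg₂ Prod.mk ?_ rfl))
  refine congrArg List.ofFn (funext fun i => ?_)
  exact List.map_ofFn

theorem val_eval_repCode {N : ℕ} {r : Realization K N} {S : ℕ → K} (h : r.Recognizes S) (k : ℕ) :
    (QminRep.eval (E.repCode (r.code enc)) k).val = E.toQmin (S k) := by
  rw [repCode_code]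
  exact QminRep.val_eval (h.map E.toQmin) _ (fun i => E.val_rep _) (fun i j => E.val_rep _)
    (fun i => E.val_rep _) k

theorem height_le {N : ℕ} (r : Realization K N) :
    r.Entries fun x => (E.toQmin x).height ≤ QminRep.codeHeight (E.repCode (r.code enc)) := by
  rw [repCode_code]
  obtain ⟨h1, h2, h3⟩ := QminRep.height_le_codeHeight (E.repTriple r)
  simp only [repTriple, Matrix.of_apply, E.val_rep] at h1 h2 h3
  exact ⟨h1, h2, h3⟩

attribute [local irreducible] Realization.heightBound Realization.ratEqualityBound QminRep.agree
  QminRep.codeHeight triples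

/-- The number of terms to compare for two encoded triples. -/
def comparisonBound (p q : RealizationCode κ) : ℕ :=
  Realization.ratEqualityBound (p.1 + q.1)
    (QminRep.codeHeight (E.repCode p) + QminRep.codeHeight (E.repCode q))

/-- The encoded triples of dimension `N` and bounded height equivalent to a given one. -/
def solutions (p : RealizationCode κ) (N : ℕ) : List (RealizationCode κ) :=
  (triples (E.elements (Realization.heightBound (p.1 + N) (QminRep.codeHeight (E.repCode p))))
    N).filterMap fun q =>
      bif QminRep.agree (E.repCode p) (E.repCode q) (E.comparisonBound p q) then some q else none

theorem primrec_comparisonBound : Primrec₂ E.comparisonBound := by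
  have h := QminRep.primrec_codeHeight.comp E.primrec_repCode
  exact Realization.primrec_ratEqualityBound.comp
    (Primrec.nat_add.comp (Primrec.fst.comp Primrec.fst) (Primrec.fst.comp Primrec.snd))
    (Primrec.nat_add.comp (h.comp Primrec.fst) (h.comp Primrec.snd))

theorem primrec_solutions : Primrec₂ E.solutions := by
  have h : Primrec fun p : RealizationCode κ => QminRep.codeHeight (E.repCode p) :=
    QminRep.primrec_codeHeight.comp E.primrec_repCode
  have hn : Primrec fun x : RealizationCode κ × ℕ => x.1.1 + x.2 :=
    Primrec.nat_add.comp (Primrec.fst.comp Primrec.fst) Primrec.snd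
  have hB : Primrec fun x : RealizationCode κ × ℕ =>
      Realization.heightBound (x.1.1 + x.2) (QminRep.codeHeight (E.repCode x.1)) :=
    Realization.primrec_heightBound.comp hn (h.comp Primrec.fst)
  have hT : Primrec fun x : RealizationCode κ × ℕ => triples (E.elements
      (Realization.heightBound (x.1.1 + x.2) (QminRep.codeHeight (E.repCode x.1)))) x.2 :=
    primrec_triples.comp (E.primrec_elements.comp hB) Primrec.snd
  have hp : Primrec fun x : (RealizationCode κ × ℕ) × RealizationCode κ => x.1.1 :=
    Primrec.fst.comp Primrec.fst
  have hG : Primrec fun x : (RealizationCode κ × ℕ) × RealizationCode κ =>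
      E.comparisonBound x.1.1 x.2 := E.primrec_comparisonBound.comp hp Primrec.snd
  have hpq : Primrec fun x : (RealizationCode κ × ℕ) × RealizationCode κ =>
      ((E.repCode x.1.1, E.repCode x.2), E.comparisonBound x.1.1 x.2) :=
    Primrec.pair (Primrec.pair (E.primrec_repCode.comp hp) (E.primrec_repCode.comp Primrec.snd)) hG
  have hag : Primrec fun x : (RealizationCode κ × ℕ) × RealizationCode κ =>
      QminRep.agree (E.repCode x.1.1) (E.repCode x.2) (E.comparisonBound x.1.1 x.2) :=
    QminRep.primrec_agree.comp hpq
  exact Primrec.listFilterMap hT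
    (Primrec.cond hag (Primrec.option_some.comp Primrec.snd) (Primrec.const none)).to₂

/-- The sums of the dimensions and of the heights bound both triples at once, so the test on
finitely many terms is conclusive. -/
theorem agree_iff {M N : ℕ} {r : Realization K M} {S : ℕ → K} (h : r.Recognizes S)
    (r' : Realization K N) :
    QminRep.agree (E.repCode (r.code enc)) (E.repCode (r'.code enc))
      (E.comparisonBound (r.code enc) (r'.code enc)) = true ↔ r'.Recognizes S := by
  rw [QminRep.agree_iff]
  constructor
  · intro heq
    have h' : r'.Recognizes fun k => r'.c ⬝ᵥ (r'.A ^ k *ᵥ r'.b) := fun k => rfl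
    simp only [E.val_eval_repCode h, E.val_eval_repCode h'] at heq
    have := (h.map E.toQmin).eq_of_forall_lt_rat (h'.map E.toQmin) (n := M + N)
      (W := QminRep.codeHeight (E.repCode (r.code enc)) +
        QminRep.codeHeight (E.repCode (r'.code enc))) (by omega) (by omega)
      ((E.height_le r).mono fun x hx => hx.trans (by omega))
      ((E.height_le r').mono fun x hx => hx.trans (by omega)) heq
    exact fun k => E.injective (congrFun this k)
  · intro h' k _
    rw [E.val_eval_repCode h, E.val_eval_repCode h']

theorem exists_of_mem_solutions {M N : ℕ} {r : Realization K M} {S : ℕ → K} (h : r.Recognizes S)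
    {q : RealizationCode κ} (hq : q ∈ E.solutions (r.code enc) N) :
    ∃ r' : Realization K N, r'.code enc = q ∧ r'.Recognizes S := by
  obtain ⟨q', hq', he⟩ := List.mem_filterMap.1 hq
  obtain ⟨r', rfl⟩ := exists_code_eq (E.exists_of_mem _) hq'
  rw [cond_eq_ite] at he
  split_ifs at he with hag
  cases he
  exact ⟨r', rfl, (E.agree_iff h r').1 hag⟩

/-- The search sees only triples of bounded height; `E.small` ensures that one of them realizes `S`
as soon as any triple of that dimension does. -/
theorem solutions_ne_nil_iff {M : ℕ} {r : Realization K M} {S : ℕ → K} (h : r.Recognizes S)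
    (N : ℕ) : E.solutions (r.code enc) N ≠ [] ↔ HasRealization S N := by
  constructor
  · intro hne
    obtain ⟨q, hq⟩ := List.exists_mem_of_ne_nil _ hne
    obtain ⟨r', -, h'⟩ := E.exists_of_mem_solutions h hq
    exact ⟨r', h'⟩
  · intro hN
    obtain ⟨r', h', hr'⟩ := E.small (n := M + N) (by omega) (by omega) (E.height_le r) h hN
    refine List.ne_nil_of_mem (a := r'.code enc) (List.mem_filterMap.2 ⟨r'.code enc,
      code_mem_triples (hr'.mono fun x hx => E.mem_elements _ x hx), ?_⟩)
    rw [(E.agree_iff h r').2 h', cond_true]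

theorem realizationProblemDecidable (E : EffectiveEmbedding enc) : RealizationProblemDecidable enc := by
  refine ⟨fun x => decide (0 < (E.solutions x.1 x.2).length), ?_, ?_⟩
  · exact (Primrec.nat_lt.comp (Primrec.const 0)
      (Primrec.list_length.comp E.primrec_solutions)).decide.to_comp
  · intro S M r h N
    rw [decide_eq_true_eq, List.length_pos_iff]
    exact E.solutions_ne_nil_iff h N

theorem minimalRealizationComputable (E : EffectiveEmbedding enc) :
    MinimalRealizationComputable enc := by
  classical
  -- The input itself realizes `S`, so dimensions up to `p.1` suffice, and the default `p` is never
  -- returned on the code of a triple.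
  refine ⟨fun p => (((List.range (p.1 + 1)).flatMap (E.solutions p)).head?).getD p, ?_, ?_⟩
  · refine (Primrec.option_getD.comp (Primrec.list_head?.comp (Primrec.list_flatMap
      (Primrec.list_range.comp (Primrec.succ.comp Primrec.fst)) E.primrec_solutions))
      Primrec.id).to_comp
  · intro S M r h
    have hex : ∃ N, E.solutions (r.code enc) N ≠ [] :=
      ⟨M, (E.solutions_ne_nil_iff h M).2 ⟨r, h⟩⟩
    have hmin : ∀ N', HasRealization S N' → Nat.find hex ≤ N' := fun N' hN' =>
      Nat.find_min' hex ((E.solutions_ne_nil_iff h N').2 hN')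
    have hle : Nat.find hex ≤ M := hmin M ⟨r, h⟩
    have hspec := Nat.find_spec hex
    have hlt : ∀ N < Nat.find hex, E.solutions (r.code enc) N = [] := fun N hN =>
      not_not.1 (Nat.find_min hex hN)
    generalize Nat.find hex = N at *
    obtain ⟨q, l, hq⟩ := List.exists_cons_of_ne_nil hspec
    obtain ⟨r', hr', h'⟩ := E.exists_of_mem_solutions h (q := q) (N := N) (by rw [hq]; simp)
    refine ⟨N, r', ?_, h', hmin⟩
    -- Dimensions below the minimal `N` contribute nothing, so the head of the whole list is the
    -- first solution of dimension `N`.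
    have e : List.range (M + 1) = List.range N ++ N :: (List.range (M - N)).map fun i => N + 1 + i := by
      rw [show M + 1 = (N + 1) + (M - N) by omega, List.range_add, List.range_succ]
      simp
    change (((List.range (M + 1)).flatMap (E.solutions (r.code enc))).head?).getD _ = _
    have e2 : (List.range N).flatMap (E.solutions (r.code enc)) = [] := by
      rw [List.flatMap_eq_nil_iff]
      exact fun i hi => hlt i (List.mem_range.1 hi)
    rw [e, List.flatMap_append, e2, List.flatMap_cons, hq, hr']
    rfl

end EffectiveEmbedding

/-! ### Primitive recursion on integers and coprimality -/

/-- The parity of the code tells the sign and its half the size, which reduces computations with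
integers to the naturals. -/
theorem Int.encode_eq (z : ℤ) : Encodable.encode z = if 0 ≤ z then 2 * z.toNat else 2 * (-z).toNat - 1 := by
  rcases z with n | n
  · rfl
  · rw [if_neg (by omega)]
    change 2 * n + 1 = _
    omega

theorem Primrec.int_toNat : Primrec Int.toNat := by
  have he : Primrec fun z : ℤ => Encodable.encode z := Primrec.encode
  refine (Primrec.ite (Primrec.eq.comp (Primrec.nat_mod.comp he (Primrec.const 2))
    (Primrec.const 0)) (Primrec.nat_div.comp he (Primrec.const 2)) (Primrec.const 0)).of_eq
    fun z => ?_
  rw [Int.encode_eq]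
  split_ifs <;> omega

theorem Primrec.int_neg_toNat : Primrec fun z : ℤ => (-z).toNat := by
  have he : Primrec fun z : ℤ => Encodable.encode z := Primrec.encode
  refine (Primrec.ite (Primrec.eq.comp (Primrec.nat_mod.comp he (Primrec.const 2))
    (Primrec.const 0)) (Primrec.const 0)
    (Primrec.succ.comp (Primrec.nat_div.comp he (Primrec.const 2)))).of_eq fun z => ?_
  rw [Int.encode_eq]
  split_ifs <;> omega

theorem Primrec.int_natCast : Primrec fun n : ℕ => (n : ℤ) := by
  refine Primrec.encode_iff.1 ((Primrec.nat_mul.comp (Primrec.const 2) Primrec.id).of_eq fun n => ?_)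
  rw [Int.encode_eq]
  simp

theorem Primrec.int_neg_natCast : Primrec fun n : ℕ => -(n : ℤ) := by
  refine Primrec.encode_iff.1 ((Primrec.nat_sub.comp (Primrec.nat_mul.comp (Primrec.const 2)
    Primrec.id) (Primrec.const 1)).of_eq fun n => ?_)
  rw [Int.encode_eq]
  simp only [id]
  split_ifs <;> omega

/-- A bounded search for common divisors; the gcd itself is in range because `d > 0`. -/
theorem Nat.coprime_iff_forall_lt (m d : ℕ) (hd : 0 < d) :
    m.Coprime d ↔ ∀ k < d + 1, m % k = 0 → d % k = 0 → k = 1 := by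
  constructor
  · intro h k _ h1 h2
    exact Nat.eq_one_of_dvd_coprimes h (Nat.dvd_of_mod_eq_zero h1) (Nat.dvd_of_mod_eq_zero h2)
  · intro h
    refine h _ (Nat.lt_succ_of_le (Nat.gcd_le_right m hd)) ?_ ?_
    · exact Nat.mod_eq_zero_of_dvd (Nat.gcd_dvd_left m d)
    · exact Nat.mod_eq_zero_of_dvd (Nat.gcd_dvd_right m d)

theorem primrecPred_coprime_succ : PrimrecPred fun p : ℕ × ℕ => p.1.Coprime (p.2 + 1) := by
  have hk : Primrec fun x : ℕ × (ℕ × ℕ) => x.1 := Primrec.fst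
  have hm : Primrec fun x : ℕ × (ℕ × ℕ) => x.2.1 := Primrec.fst.comp Primrec.snd
  have hd : Primrec fun x : ℕ × (ℕ × ℕ) => x.2.2 + 1 :=
    Primrec.succ.comp (Primrec.snd.comp Primrec.snd)
  have hR : PrimrecRel fun (k : ℕ) (p : ℕ × ℕ) =>
      ¬(p.1 % k = 0 ∧ (p.2 + 1) % k = 0) ∨ k = 1 :=
    PrimrecPred.or (PrimrecPred.not (PrimrecPred.and
      (Primrec.eq.comp (Primrec.nat_mod.comp hm hk) (Primrec.const 0))
      (Primrec.eq.comp (Primrec.nat_mod.comp hd hk) (Primrec.const 0))))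
      (Primrec.eq.comp hk (Primrec.const 1))
  refine (hR.forall_mem_list.comp (f := fun p : ℕ × ℕ => List.range (p.2 + 2))
    (g := fun p : ℕ × ℕ => p) (Primrec.list_range.comp
      (Primrec.succ.comp (Primrec.succ.comp Primrec.snd))) Primrec.id).of_eq fun p => ?_
  rw [Nat.coprime_iff_forall_lt _ _ (Nat.succ_pos _)]
  simp only [List.mem_range]
  refine forall₂_congr fun k _ => ?_
  tauto

/-! ### Effective embeddings of the three semirings -/

/-- The embedding of `Zmax` into `Zmin` given by `x ↦ -x`. -/
def Zmax.toZmin : Zmax →+* Zmin :=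
  Tropical.mapWithTop (Γ := ℤᵒᵈ) (Δ := ℤ)
    ⟨⟨fun x => -OrderDual.ofDual x, rfl⟩, fun _ _ => neg_add _ _⟩
    fun _ _ h => Int.neg_le_neg h

theorem Zmax.toZmin_bijective : Function.Bijective Zmax.toZmin := by
  refine ⟨Tropical.mapWithTop_injective _ _ fun _ _ h => Int.neg_inj.1 h, fun y => ?_⟩
  induction y using Tropical.tropRec with
  | h y =>
    induction y using WithTop.recTopCoe with
    | top => exact ⟨0, rfl⟩
    | coe m =>
      refine ⟨Tropical.trop ((OrderDual.toDual (-m) : ℤᵒᵈ) : WithTop ℤᵒᵈ), ?_⟩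
      change Zmin.ofInt (- -m) = _
      rw [neg_neg]; rfl

/-- The embedding of `Qmax` into `Qmin` given by `x ↦ -x`. -/
def Qmax.toQmin : Qmax →+* Qmin :=
  Tropical.mapWithTop (Γ := ℚᵒᵈ) (Δ := ℚ)
    ⟨⟨fun x => -OrderDual.ofDual x, rfl⟩, fun _ _ => neg_add _ _⟩
    fun _ _ h => neg_le_neg h

theorem Qmax.toQmin_bijective : Function.Bijective Qmax.toQmin := by
  refine ⟨Tropical.mapWithTop_injective _ _ fun _ _ h => neg_injective h, fun y => ?_⟩
  rcases Qmin.eq_zero_or_ofRat y with rfl | ⟨q, rfl⟩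
  · exact ⟨0, rfl⟩
  · refine ⟨Tropical.trop ((OrderDual.toDual (-q) : ℚᵒᵈ) : WithTop ℚᵒᵈ), ?_⟩
    change Qmin.ofRat (- -q) = _
    rw [neg_neg]

/-- Naturals as elements of `Qmin`. -/
def Nmin.effectiveEmbedding : EffectiveEmbedding Nmin.encode where
  toQmin := Zmin.toQmin.comp Nmin.toZmin
  injective := Zmin.toQmin_injective.comp Nmin.toZmin_injective
  rep x := x.map fun n => (n, 0, 0)
  primrec_rep := Primrec.option_map Primrec.id
    (Primrec.pair Primrec.snd (Primrec.const (0, 0))).to₂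
  val_rep x := by
    induction x using Tropical.tropRec with
    | h x =>
      induction x using WithTop.recTopCoe with
      | top => rfl
      | coe n =>
        change Qmin.ofRat (((n : ℚ) - (0 : ℕ)) / ((0 : ℕ) + 1)) = Qmin.ofRat ((n : ℤ) : ℚ)
        simp
  -- The height of `n` is `n + 1`, the denominator counting for one, so `n < B` suffices.
  elements B := none :: (List.range B).map some
  primrec_elements := Primrec.list_cons.comp (Primrec.const none)
    (Primrec.list_map Primrec.list_range (Primrec.option_some.comp Primrec.snd).to₂)
  exists_of_mem B y _ := by
    rcases y with _ | n
    · exact ⟨0, rfl⟩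
    · exact ⟨Tropical.trop (n : WithTop ℕ), rfl⟩
  mem_elements B x hx := by
    induction x using Tropical.tropRec with
    | h x =>
      induction x using WithTop.recTopCoe with
      | top => exact List.mem_cons_self
      | coe n =>
        change (Zmin.toQmin (Zmin.ofInt n)).height ≤ B at hx
        rw [Zmin.height_toQmin, Zmin.toInt_ofInt, Int.natAbs_natCast] at hx
        exact List.mem_cons_of_mem _ (List.mem_map.2 ⟨n, List.mem_range.2 (by omega), rfl⟩)
  small := Realization.smallRealizations_Nmin

/-- Integers as elements of `Qmin`. -/
def Zmax.effectiveEmbedding : EffectiveEmbedding Zmax.encode where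
  toQmin := Zmin.toQmin.comp Zmax.toZmin
  injective := Zmin.toQmin_injective.comp Zmax.toZmin_bijective.1
  -- The difference of the two parts is `-z`, in accordance with the change of sign.
  rep x := x.map fun z => ((-z).toNat, z.toNat, 0)
  primrec_rep := Primrec.option_map Primrec.id
    (Primrec.pair (Primrec.int_neg_toNat.comp Primrec.snd)
      (Primrec.pair (Primrec.int_toNat.comp Primrec.snd) (Primrec.const 0))).to₂
  val_rep x := by
    induction x using Tropical.tropRec with
    | h x =>
      induction x using WithTop.recTopCoe with
      | top => rfl
      | coe z =>
        change Qmin.ofRat ((((-OrderDual.ofDual z).toNat : ℚ) - ((OrderDual.ofDual z).toNat : ℕ)) /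
          ((0 : ℕ) + 1)) = Qmin.ofRat ((-OrderDual.ofDual z : ℤ) : ℚ)
        congr 1
        rw [Nat.cast_zero, zero_add, div_one]
        have : ((-OrderDual.ofDual z).toNat : ℤ) - (OrderDual.ofDual z).toNat =
          -OrderDual.ofDual z := by omega
        exact_mod_cast this
  elements B := none :: (List.range B).flatMap fun n : ℕ => [some (n : ℤ), some (-n : ℤ)]
  primrec_elements := Primrec.list_cons.comp (Primrec.const none)
    (Primrec.list_flatMap Primrec.list_range
      (Primrec.list_cons.comp (Primrec.option_some.comp (Primrec.int_natCast.comp Primrec.snd))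
        (Primrec.list_cons.comp (Primrec.option_some.comp (Primrec.int_neg_natCast.comp Primrec.snd))
          (Primrec.const []))).to₂)
  exists_of_mem B y _ := by
    rcases y with _ | z
    · exact ⟨0, rfl⟩
    · exact ⟨Tropical.trop ((OrderDual.toDual z : ℤᵒᵈ) : WithTop ℤᵒᵈ), rfl⟩
  mem_elements B x hx := by
    induction x using Tropical.tropRec with
    | h x =>
      induction x using WithTop.recTopCoe with
      | top => exact List.mem_cons_self
      | coe z =>
        change (Zmin.toQmin (Zmin.ofInt (-OrderDual.ofDual z))).height ≤ B at hx
        rw [Zmin.height_toQmin, Zmin.toInt_ofInt, Int.natAbs_neg] at hx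
        refine List.mem_cons_of_mem _ (List.mem_flatMap.2 ⟨(OrderDual.ofDual z).natAbs,
          List.mem_range.2 (by omega), ?_⟩)
        change some (OrderDual.ofDual z) ∈ _
        rcases Int.natAbs_eq (OrderDual.ofDual z) with h | h
        · rw [← h]; exact List.mem_cons_self
        · rw [← h]; exact List.mem_cons_of_mem _ List.mem_cons_self
  small := Realization.smallRealizations_Zmin.of_bijective _ Zmax.toZmin_bijective

/-- The reduced fractions with numerator `± m` and denominator `d + 1`. -/
def signedFractions (p : ℕ × ℕ) : List (Option (ℤ × ℕ)) :=
  if p.1.Coprime (p.2 + 1) then [some (p.1, p.2 + 1), some (-p.1, p.2 + 1)] else []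

theorem primrec_signedFractions : Primrec signedFractions := by
  have hd : Primrec fun p : ℕ × ℕ => p.2 + 1 := Primrec.succ.comp Primrec.snd
  exact Primrec.ite primrecPred_coprime_succ
    (Primrec.list_cons.comp (Primrec.option_some.comp
      (Primrec.pair (Primrec.int_natCast.comp Primrec.fst) hd))
      (Primrec.list_cons.comp (Primrec.option_some.comp
        (Primrec.pair (Primrec.int_neg_natCast.comp Primrec.fst) hd)) (Primrec.const [])))
    (Primrec.const [])

/-- Rationals as elements of `Qmin`. -/
def Qmax.effectiveEmbedding : EffectiveEmbedding Qmax.encode where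
  toQmin := (RingHom.id Qmin).comp Qmax.toQmin
  injective := Qmax.toQmin_bijective.1
  rep x := x.map fun q => ((-q.1).toNat, q.1.toNat, q.2 - 1)
  primrec_rep := Primrec.option_map Primrec.id
    (Primrec.pair (Primrec.int_neg_toNat.comp (Primrec.fst.comp Primrec.snd))
      (Primrec.pair (Primrec.int_toNat.comp (Primrec.fst.comp Primrec.snd))
        (Primrec.pred.comp (Primrec.snd.comp Primrec.snd)))).to₂
  val_rep x := by
    induction x using Tropical.tropRec with
    | h x =>
      induction x using WithTop.recTopCoe with
      | top => rfl
      | coe q =>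
        change Qmin.ofRat ((((-(OrderDual.ofDual q).num).toNat : ℚ) -
          ((OrderDual.ofDual q).num.toNat : ℕ)) / (((OrderDual.ofDual q).den - 1 : ℕ) + 1)) =
          Qmin.ofRat (-OrderDual.ofDual q)
        generalize OrderDual.ofDual q = a
        congr 1
        have h1 : ((-a.num).toNat : ℤ) - a.num.toNat = -a.num := by omega
        have h2 : ((-a.num).toNat : ℚ) - a.num.toNat = -a.num := by exact_mod_cast h1
        have h3 : ((a.den - 1 : ℕ) : ℚ) + 1 = a.den := by
          have := a.den_pos
          norm_cast
          omega
        rw [h2, h3, neg_div, Rat.num_div_den]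
  elements B := none :: (List.range B).flatMap fun m =>
    (List.range B).flatMap fun d => signedFractions (m, d)
  primrec_elements := Primrec.list_cons.comp (Primrec.const none)
    (Primrec.list_flatMap Primrec.list_range
      (Primrec.list_flatMap (Primrec.list_range.comp Primrec.fst)
        (primrec_signedFractions.comp
          (Primrec.pair (Primrec.snd.comp Primrec.fst) Primrec.snd)).to₂).to₂)
  exists_of_mem B y hy := by
    rcases List.mem_cons.1 hy with rfl | hy
    · exact ⟨0, rfl⟩
    · obtain ⟨m, -, hy⟩ := List.mem_flatMap.1 hy
      obtain ⟨d, -, hy⟩ := List.mem_flatMap.1 hy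
      -- Codes are reduced fractions, so coprimality is what makes a listed pair the code of a
      -- rational.
      have key : ∀ z : ℤ, z.natAbs.Coprime (d + 1) →
          ∃ x : Qmax, x.encode = some (z, d + 1) := fun z hz =>
        ⟨Tropical.trop ((OrderDual.toDual (⟨z, d + 1, by omega, hz⟩ : ℚ) : ℚᵒᵈ) : WithTop ℚᵒᵈ), rfl⟩
      rw [signedFractions] at hy
      split_ifs at hy with hc
      · simp only [List.mem_cons, List.not_mem_nil, or_false] at hy
        rcases hy with rfl | rfl
        · exact key _ (by simpa using hc)
        · exact key _ (by simpa using hc)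
      · simp at hy
  mem_elements B x hx := by
    induction x using Tropical.tropRec with
    | h x =>
      induction x using WithTop.recTopCoe with
      | top => exact List.mem_cons_self
      | coe q =>
        change (-OrderDual.ofDual q).num.natAbs + (-OrderDual.ofDual q).den ≤ B at hx
        change some ((OrderDual.ofDual q).num, (OrderDual.ofDual q).den) ∈ _
        generalize OrderDual.ofDual q = a at *
        rw [Rat.neg_num, Rat.neg_den, Int.natAbs_neg] at hx
        have hpos := a.den_pos
        refine List.mem_cons_of_mem _ (List.mem_flatMap.2 ⟨a.num.natAbs,
          List.mem_range.2 (by omega), List.mem_flatMap.2 ⟨a.den - 1,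
          List.mem_range.2 (by omega), ?_⟩⟩)
        have hd : a.den - 1 + 1 = a.den := by omega
        simp only [signedFractions, hd, if_pos a.reduced]
        rcases Int.natAbs_eq a.num with h | h
        · rw [← h]; exact List.mem_cons_self
        · rw [← h]; exact List.mem_cons_of_mem _ List.mem_cons_self
  small := Realization.smallRealizations_Qmin.of_bijective _ Qmax.toQmin_bijective

theorem corollary1 :
    (RealizationProblemDecidable Qmax.encode ∧
      RealizationProblemDecidable Zmax.encode ∧
      RealizationProblemDecidable Nmin.encode) ∧
    (MinimalRealizationComputable Qmax.encode ∧
      MinimalRealizationComputable Zmax.encode ∧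
      MinimalRealizationComputable Nmin.encode) :=
  ⟨⟨Qmax.effectiveEmbedding.realizationProblemDecidable,
      Zmax.effectiveEmbedding.realizationProblemDecidable,
      Nmin.effectiveEmbedding.realizationProblemDecidable⟩,
    Qmax.effectiveEmbedding.minimalRealizationComputable,
    Zmax.effectiveEmbedding.minimalRealizationComputable,
    Nmin.effectiveEmbedding.minimalRealizationComputable⟩
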